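/- **Setting.** Let $D\subset\mathbb R^2$ be a polygonal domain with a coarse grid $\mathcal T^H$, a conforming partition of $\overline D$ into closed convex polygons $K_1,\dots,K_N$ (triangles or rectangles, for instance) with largest diameter $H$, and let $\mathcal T^h$ be a conforming triangulation of $\overline D$ with largest diameter $h$ that refines $\mathcal T^H$. $\mathcal E^H$ is the set of edges of $\mathcal T^H$. Let $\kappa$ be measurable and bounded with $\kappa\ge1$ a.e. in $D$, and $f\in L^2(D)$. Let $\kappa_K=\operatorname{ess\,sup}_K\kappa$. On an interior edge $E$ shared by $K^+,K^-$, with fixed unit normal $n_E$ pointing from $K^+$ to $K^-$, put $\{G\}=\frac12(G^++G^-)$, $[G]=G^+-G^-$, $\overline\kappa=\frac12(\kappa_{K^+}+\kappa_{K^-})$; on a boundary edge of a block $K$, with $n_E$ outward, put $\{G\}=[G]=G$, $\overline\kappa=\kappa_K$. On a block $K$ let $\widetilde\kappa$ be the maximum of $\overline\kappa$ over the edges of $K$. *Spaces and fluxes.* $V_h(K)$ is the space of continuous functions on $K$ that are affine on each fine triangle in $K$; $V_h^0(K)$ is its subspace of functions vanishing on $\partial K$; $V_h(\partial K)$ is the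 space of restrictions to $\partial K$; $V^h_{DG}=\{v\in L^2(D): v|_K\in V_h(K)\ \forall K\in\mathcal T^H\}$. Write $a_K(u,v)=\int_K\kappa\nabla u\cdot\nabla v$. The harmonic extension of $g\in V_h(\partial K)$ is the $\widehat g\in V_h(K)$ with $\widehat g=g$ on $\partial K$ and $a_K(\widehat g,w)=0$ for all $w\in V_h^0(K)$. For $u\in V_h(K)$ the flux $\kappa\nabla u\cdot n_{\partial K}$ is the element of $V_h(\partial K)$ with $\int_{\partial K}(\kappa\nabla u\cdot n_{\partial K})\,g=a_K(u,\widehat g)$ for all $g\in V_h(\partial K)$; accordingly $\kappa\nabla u\cdot n_E=\pm\kappa\nabla u|_{K^\pm}\cdot n_{\partial K^\pm}$ on $E$ from the side of $K^\pm$. For $\gamma>0$ let $$a_{DG}(u,v)=\sum_K a_K(u,v)-\sum_{E\in\mathcal E^H}\int_E\big(\{\kappa\nabla u\cdot n_E\}[v]+\{\kappa\nabla v\cdot n_E\}[u]\big)+\sum_{E\in\mathcal E^H}\frac\gamma h\int_E\overline\kappa[u][v],$$ $$\|u\|_{DG}^2=\sum_K a_K(u,u)+\sum_{E\in\mathcal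 E^H}\frac\gamma h\int_E\overline\kappa[u]^2 .$$ *Inverse inequality.* $C_{inv}>0$ denotes a constant such that $a_K(\widehat g,\widehat g)\le\kappa_K C_{inv}^2h^{-1}\int_{\partial K}|g|^2$ for all $K\in\mathcal T^H$ and $g\in V_h(\partial K)$. *Spectral problems.* On each $K_i$ let $V_1^{i,snap}$ be the span of all harmonic extensions, $M_{1,i}=\dim V_1^{i,snap}$, $M_{2,i}=\dim V_h^0(K_i)$, and let $(\phi^{(i)}_k,\lambda^{(i)}_{1,k})_{1\le k\le M_{1,i}}$ with $\phi_k^{(i)}\in V_1^{i,snap}\setminus\{0\}$ and $(\xi^{(i)}_k,\lambda^{(i)}_{2,k})_{1\le k\le M_{2,i}}$ with $\xi_k^{(i)}\in V_h^0(K_i)\setminus\{0\}$ be eigenpairs of $$a_{K_i}(\phi^{(i)}_k,v)=\frac{\lambda^{(i)}_{1,k}}{H}\int_{\partial K_i}\widetilde\kappa\,\phi^{(i)}_kv\quad\forall v\in V_1^{i,snap},\qquad a_{K_i}(\xi^{(i)}_k,v)=\frac{\lambda^{(i)}_{2,k}}{H^2}\int_{K_i}\kappa\,\xi^{(i)}_kv\quad\forall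 v\in V_h^0(K_i),$$ where, as an assumption, $\lambda^{(i)}_{j,1}<\lambda^{(i)}_{j,2}<\cdots$ for $j=1,2$. Fix $1\le l_{1,i}\le M_{1,i}$ and $0\le l_{2,i}\le M_{2,i}$, let $V^{off}$ be the space of functions whose restriction to each $K_i$ lies in $\operatorname{span}\{\phi^{(i)}_k\}_{k\le l_{1,i}}+\operatorname{span}\{\xi^{(i)}_k\}_{k\le l_{2,i}}$, and read $1/\lambda^{(i)}_{j,l_{j,i}+1}$ as $0$ if $l_{j,i}=M_{j,i}$. **Theorem.** For every pair of grids there is a constant $C_{inv}>0$ that satisfies the inverse inequality for all coefficients $\kappa$. Let, for any grids, $\kappa$ and $f$, the constant $C_{inv}$ be any constant satisfying the inverse inequality, let $\gamma>C_{inv}^2$, let $u_h\in V^h_{DG}$ satisfy $a_{DG}(u_h,v)=(f,v)$ for all $v\in V^h_{DG}$ (fine grid solution), let $u_H\in V^{off}$ satisfy $a_{DG}(u_H,v)=(f,v)$ for all $v\in V^{off}$ (GMsDGM solution), and let $u_1|_{K_i}$ be the harmonic extension of $u_h|_{\partial K_i}$ for every $i$. Then $$\|u_h-u_H\|_{DG}^2\le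 C\Big(\sum_{i=1}^N\frac{H}{\widetilde\kappa\,\lambda^{(i)}_{1,l_{1,i}+1}}\Big(1+\frac{\gamma H}{h\,\lambda^{(i)}_{1,l_{1,i}+1}}\Big)\int_{\partial K_i}(\kappa\nabla u_1\cdot n_{\partial K_i})^2+\sum_{i=1}^N\frac{H^2}{\lambda^{(i)}_{2,l_{2,i}+1}}\|f\|_{L^2(K_i)}^2+C_{inv}^2\sum_{E\in\mathcal E^H}\frac1h\int_E\overline\kappa\,[u_h]^2\Big),$$ where $C$ depends only on $1-C_{inv}\gamma^{-1/2}$ (and not on the grids, $\kappa$, $f$, or the numbers $l_{j,i}$). -/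

import Mathlib

open MeasureTheory

namespace GMsDG

noncomputable section

abbrev Plane : Type := EuclideanSpace ℝ (Fin 2)

/-- The closed convex polygon (or segment) spanned by a finite set of vertices. -/
abbrev poly (s : Finset Plane) : Set Plane := convexHull ℝ (s : Set Plane)

/-- A conforming mesh of a planar polygonal region by convex polygons.
A cell is given by the finite set of its vertices. -/
structure PolyMesh where
  cells : Finset (Finset Plane)
  convexIndependent : ∀ K ∈ cells, ConvexIndependent ℝ ((↑) : K → Plane)
  interior_nonempty : ∀ K ∈ cells, (interior (poly K)).Nonempty
  disjoint_interior : ∀ K ∈ cells, ∀ L ∈ cells, K ≠ L →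
    Disjoint (interior (poly K)) (interior (poly L))
  conforming : ∀ K ∈ cells, ∀ L ∈ cells,
    poly K ∩ poly L = convexHull ℝ ((K : Set Plane) ∩ (L : Set Plane))

/-- The closed region covered by the mesh (the closure of the computational domain). -/
def PolyMesh.region (M : PolyMesh) : Set Plane := ⋃ K ∈ M.cells, poly K

/-- The mesh size: the largest diameter of a cell. -/
def PolyMesh.size (M : PolyMesh) : ℝ :=
  sSup ((fun K : Finset Plane => Metric.diam (poly K)) '' (M.cells : Set (Finset Plane)))

open Classical in
/-- The edges of a convex polygon, each given by its two endpoints: the pairs of vertices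
whose segment lies on the boundary of the polygon. -/
def cellEdges (K : Finset Plane) : Finset (Finset Plane) :=
  (K.powersetCard 2).filter (fun e => poly e ⊆ frontier (poly K))

open Classical in
/-- All edges of a mesh. -/
def PolyMesh.edges (M : PolyMesh) : Finset (Finset Plane) := M.cells.biUnion cellEdges

/-- An edge is interior when it is an edge of two different cells. -/
def PolyMesh.IsInterior (M : PolyMesh) (e : Finset Plane) : Prop :=
  ∃ K ∈ M.cells, ∃ L ∈ M.cells, K ≠ L ∧ e ∈ cellEdges K ∧ e ∈ cellEdges L

/-- A coarse grid, a fine triangulation refining it, and on every coarse edge a fixed unit normal.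
The normal of an interior edge `e` is recorded by the cells it points from (`plus e`) and
to (`minus e`); on a boundary edge it is the outward normal and `plus e` is the only adjacent
cell (then `minus e` is irrelevant). -/
structure Grids where
  coarse : PolyMesh
  fine : PolyMesh
  fine_triangle : ∀ T ∈ fine.cells, T.card = 3
  fine_subset : ∀ T ∈ fine.cells, ∃ K ∈ coarse.cells, poly T ⊆ poly K
  coarse_eq : ∀ K ∈ coarse.cells,
    poly K = ⋃ T ∈ {T : Finset Plane | T ∈ fine.cells ∧ poly T ⊆ poly K}, poly T
  plus : Finset Plane → Finset Plane
  minus : Finset Plane → Finset Plane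
  plus_mem : ∀ e ∈ coarse.edges, plus e ∈ coarse.cells ∧ e ∈ cellEdges (plus e)
  minus_mem : ∀ e ∈ coarse.edges, coarse.IsInterior e →
    minus e ∈ coarse.cells ∧ e ∈ cellEdges (minus e) ∧ minus e ≠ plus e

/-- The arc length integral over the segment with endpoint set `e`. -/
def edgeIntegral (e : Finset Plane) (g : Plane → ℝ) : ℝ := ∫ x in poly e, g x ∂μH[1]

/-- The boundary of a polygon, as the union of its edges. -/
def bdry (K : Finset Plane) : Set Plane := ⋃ e ∈ cellEdges K, poly e

/-- The integral over the boundary of a polygon. -/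
def bdryIntegral (K : Finset Plane) (g : Plane → ℝ) : ℝ := ∑ e ∈ cellEdges K, edgeIntegral e g

/-- Admissible coefficients: measurable, bounded and at least one, almost everywhere on
the domain. -/
structure IsCoefficient (G : Grids) (κ : Plane → ℝ) : Prop where
  aemeasurable : AEMeasurable κ (volume.restrict G.coarse.region)
  one_le : ∀ᵐ x ∂(volume.restrict G.coarse.region), 1 ≤ κ x
  bounded : ∃ B : ℝ, ∀ᵐ x ∂(volume.restrict G.coarse.region), κ x ≤ B

/-- The (essential) maximum of the coefficient over a cell. -/
def cellMax (κ : Plane → ℝ) (K : Finset Plane) : ℝ := essSup κ (volume.restrict (poly K))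

/-- The energy form `∫_K κ ∇u · ∇v`. For piecewise affine functions the gradient exists off a
null set. -/
def energy (κ : Plane → ℝ) (K : Finset Plane) (u v : Plane → ℝ) : ℝ :=
  ∫ x in poly K, κ x * inner ℝ (gradient u x) (gradient v x)

/-- The conforming piecewise linear space on the coarse cell `K` with respect to the fine grid.
Functions on `K` are represented by their extension by zero to the plane. -/
def Vh (G : Grids) (K : Finset Plane) : Submodule ℝ (Plane → ℝ) where
  carrier := {v | (∀ x, x ∉ poly K → v x = 0) ∧ ContinuousOn v (poly K) ∧
    ∀ T ∈ G.fine.cells, poly T ⊆ poly K → ∃ A : Plane →ᵃ[ℝ] ℝ, Set.EqOn v A (poly T)}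
  zero_mem' := ⟨fun _ _ => rfl, continuousOn_const, fun _ _ _ => ⟨0, fun _ _ => rfl⟩⟩
  add_mem' := by
    rintro u v ⟨hu, cu, au⟩ ⟨hv, cv, av⟩
    refine ⟨fun x hx => by simp [hu x hx, hv x hx], cu.add cv, fun T hT hTK => ?_⟩
    obtain ⟨A, hA⟩ := au T hT hTK
    obtain ⟨B, hB⟩ := av T hT hTK
    exact ⟨A + B, fun x hx => by simp [hA hx, hB hx]⟩
  smul_mem' := by
    rintro c v ⟨hv, cv, av⟩
    refine ⟨fun x hx => by simp [hv x hx], cv.const_smul c, fun T hT hTK => ?_⟩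
    obtain ⟨A, hA⟩ := av T hT hTK
    exact ⟨c • A, fun x hx => by simp [hA hx]⟩

/-- The functions of `Vh G K` that vanish on the boundary of `K`. This is also the second
snapshot space. -/
def Vh0 (G : Grids) (K : Finset Plane) : Submodule ℝ (Plane → ℝ) where
  carrier := {v | v ∈ Vh G K ∧ ∀ x ∈ bdry K, v x = 0}
  zero_mem' := ⟨(Vh G K).zero_mem, fun _ _ => rfl⟩
  add_mem' := by
    rintro u v ⟨hu, bu⟩ ⟨hv, bv⟩
    exact ⟨(Vh G K).add_mem hu hv, fun x hx => by simp [bu x hx, bv x hx]⟩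
  smul_mem' := by
    rintro c v ⟨hv, bv⟩
    exact ⟨(Vh G K).smul_mem c hv, fun x hx => by simp [bv x hx]⟩

/-- The traces on the boundary of `K` of the functions of `Vh G K`, extended by zero to
the plane. -/
def VhBdry (G : Grids) (K : Finset Plane) : Set (Plane → ℝ) :=
  {g | ∃ v ∈ Vh G K, g = (bdry K).indicator v}

/-- `v` is the discrete harmonic extension to `K` of the boundary values of `g`. -/
def IsHarmonicExt (G : Grids) (κ : Plane → ℝ) (K : Finset Plane) (g v : Plane → ℝ) : Prop :=
  v ∈ Vh G K ∧ (∀ w ∈ Vh0 G K, energy κ K v w = 0) ∧ ∀ x ∈ bdry K, v x = g x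

/-- The first snapshot space: the span of all discrete harmonic extensions. -/
def Vsnap1 (G : Grids) (κ : Plane → ℝ) (K : Finset Plane) : Submodule ℝ (Plane → ℝ) :=
  Submodule.span ℝ {v | ∃ g ∈ VhBdry G K, IsHarmonicExt G κ K g v}

/-- `F` is the outward normal flux of `u` on the boundary of `K`: the trace function with
`∫_{∂K} F g = ∫_K κ ∇u · ∇ĝ` for every trace function `g`, where `ĝ` is the harmonic extension
of `g`. -/
def IsFlux (G : Grids) (κ : Plane → ℝ) (K : Finset Plane) (u F : Plane → ℝ) : Prop :=
  F ∈ VhBdry G K ∧ ∀ g ∈ VhBdry G K, ∀ v, IsHarmonicExt G κ K g v →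
    bdryIntegral K (fun x => F x * g x) = energy κ K u v

/-- The outward normal flux of `u` on the boundary of `K` (the unique `F` with `IsFlux`). -/
def flux (G : Grids) (κ : Plane → ℝ) (K : Finset Plane) (u : Plane → ℝ) : Plane → ℝ :=
  Classical.epsilon (IsFlux G κ K u)

/-- A piecewise function on the coarse grid: its restriction to each coarse cell. -/
abbrev Broken : Type := Finset Plane → Plane → ℝ

/-- Membership in the fine discontinuous space. -/
def MemVDG (G : Grids) (v : Broken) : Prop := ∀ K ∈ G.coarse.cells, v K ∈ Vh G K

open Classical in
/-- The jump over a coarse edge. -/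
def jump (G : Grids) (e : Finset Plane) (v : Broken) (x : Plane) : ℝ :=
  if G.coarse.IsInterior e then v (G.plus e) x - v (G.minus e) x else v (G.plus e) x

open Classical in
/-- The average over a coarse edge of the flux `κ ∇v · n_e`; the fixed normal `n_e` is the
outward normal of `plus e` and the inward normal of `minus e`. -/
def avgFlux (G : Grids) (κ : Plane → ℝ) (e : Finset Plane) (v : Broken) (x : Plane) : ℝ :=
  if G.coarse.IsInterior e then
    (flux G κ (G.plus e) (v (G.plus e)) x + (-flux G κ (G.minus e) (v (G.minus e)) x)) / 2
  else flux G κ (G.plus e) (v (G.plus e)) x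

open Classical in
/-- The edge weight `κ̄`. -/
def edgeKappa (G : Grids) (κ : Plane → ℝ) (e : Finset Plane) : ℝ :=
  if G.coarse.IsInterior e then (cellMax κ (G.plus e) + cellMax κ (G.minus e)) / 2
  else cellMax κ (G.plus e)

/-- The cell weight `κ̃`: the maximum of `κ̄` over the edges of the cell. -/
def cellKappa (G : Grids) (κ : Plane → ℝ) (K : Finset Plane) : ℝ :=
  sSup (edgeKappa G κ '' (cellEdges K : Set (Finset Plane)))

/-- The interior penalty bilinear form with penalty parameter `γ`. -/
def aDG (G : Grids) (κ : Plane → ℝ) (γ : ℝ) (u v : Broken) : ℝ :=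
  ∑ K ∈ G.coarse.cells, energy κ K (u K) (v K)
    - ∑ e ∈ G.coarse.edges, edgeIntegral e (fun x =>
        avgFlux G κ e u x * jump G e v x + avgFlux G κ e v x * jump G e u x)
    + ∑ e ∈ G.coarse.edges, γ / G.fine.size *
        edgeIntegral e (fun x => edgeKappa G κ e * (jump G e u x * jump G e v x))

/-- The square of the DG norm. -/
def dgNormSq (G : Grids) (κ : Plane → ℝ) (γ : ℝ) (u : Broken) : ℝ :=
  ∑ K ∈ G.coarse.cells, energy κ K (u K) (u K)
    + ∑ e ∈ G.coarse.edges, γ / G.fine.size *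
        edgeIntegral e (fun x => edgeKappa G κ e * jump G e u x ^ 2)

/-- The load functional `(f, v)`. -/
def load (G : Grids) (f : Plane → ℝ) (v : Broken) : ℝ :=
  ∑ K ∈ G.coarse.cells, ∫ x in poly K, f x * v K x

/-- `c` is an admissible constant in the inverse inequality
`∫_K κ |∇ĝ|² ≤ κ_K c² h⁻¹ ∫_{∂K} |g|²` for all coarse cells `K` and all trace functions `g`,
with `ĝ` the harmonic extension of `g`. -/
def IsInverseConstant (G : Grids) (κ : Plane → ℝ) (c : ℝ) : Prop :=
  0 < c ∧ ∀ K ∈ G.coarse.cells, ∀ g ∈ VhBdry G K, ∀ v, IsHarmonicExt G κ K g v →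
    energy κ K v v ≤ cellMax κ K * c ^ 2 * (G.fine.size)⁻¹ * bdryIntegral K (fun x => g x ^ 2)

/-- `(φ k, lam k)`, for `k = 1, …, dim V`, are eigenpairs of `a(φ, v) = lam · m(φ, v)`, `v ∈ V`,
with strictly increasing eigenvalues. -/
structure IsEigenSystem (V : Submodule ℝ (Plane → ℝ)) (a m : (Plane → ℝ) → (Plane → ℝ) → ℝ)
    (φ : ℕ → Plane → ℝ) (lam : ℕ → ℝ) : Prop where
  mem : ∀ k ∈ Set.Icc 1 (Module.finrank ℝ V), φ k ∈ V
  ne_zero : ∀ k ∈ Set.Icc 1 (Module.finrank ℝ V), φ k ≠ 0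
  eigen : ∀ k ∈ Set.Icc 1 (Module.finrank ℝ V), ∀ v ∈ V, a (φ k) v = lam k * m (φ k) v
  strictMono : StrictMonoOn lam (Set.Icc 1 (Module.finrank ℝ V))

/-- The mass form `H⁻¹ ∫_{∂K} κ̃ u v` of the first spectral problem. -/
def mass1 (G : Grids) (κ : Plane → ℝ) (K : Finset Plane) (u v : Plane → ℝ) : ℝ :=
  (G.coarse.size)⁻¹ * bdryIntegral K (fun x => cellKappa G κ K * (u x * v x))

/-- The mass form `H⁻² ∫_K κ u v` of the second spectral problem. -/
def mass2 (G : Grids) (κ : Plane → ℝ) (K : Finset Plane) (u v : Plane → ℝ) : ℝ :=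
  (G.coarse.size ^ 2)⁻¹ * ∫ x in poly K, κ x * (u x * v x)

/-- The local offline space: the span of the first `l₁` eigenfunctions `φ` and the first `l₂`
eigenfunctions `ξ`. -/
def Voff (φ ξ : ℕ → Plane → ℝ) (l₁ l₂ : ℕ) : Submodule ℝ (Plane → ℝ) :=
  Submodule.span ℝ (φ '' Set.Icc 1 l₁) ⊔ Submodule.span ℝ (ξ '' Set.Icc 1 l₂)

/-- The reciprocal `1 / lam (l + 1)` of the first eigenvalue that is not used, among
`lam 1, …, lam M`; it is `0` (that is, the eigenvalue is `∞`) if all of them are used. -/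
def invNext (lam : ℕ → ℝ) (M l : ℕ) : ℝ := if l < M then 1 / lam (l + 1) else 0

end

end GMsDG

/-! Write `θ = C_inv / √γ < 1`. The form `aDG` is symmetric and differs from the squared DG norm
only by the consistency terms. Since fluxes are defined by duality with harmonic extensions, the
inverse inequality dualises to `∫_{∂K} flux² ≤ κ_K C_inv² h⁻¹ a_K(u, u)`
(`bdryIntegral_flux_sq_le`), and Young's inequality bounds the difference by `θ ‖u‖²`
(`abs_aDG_sub_dgNormSq_le`). Galerkin orthogonality and symmetry make `a(u_h - v, u_h - v)` the sum
of `a(u_h - u_H, u_h - u_H)` and `a(u_H - v, u_H - v)` for `v` in the offline space, so `(1 - θ)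
‖u_h - u_H‖² ≤ (1 + θ) ‖u_h - v‖² ≤ 2 ‖u_h - v‖²` (`dgNormSq_galerkin_le`).

It remains to choose `v` block by block (`exists_offline_approx`). On a block `u_h = u_1 + u_2` with
`u_1` harmonic and `u_2` vanishing on the boundary; the two parts are energy orthogonal, and each is
approximated by truncating its eigenvector expansion. The residual `w` of `u_1` satisfies `a(w, w) =
a(u_1, w) = ∫ flux(u_1) w`, while the spectral gap gives `κ̃ ∫ w² ≤ (H/λ) a(w, w)`; hence `a(w, w) ≤
H/(κ̃ λ) ∫ flux(u_1)²`, and a second use of the gap controls the penalty of `w`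
(`exists_harmonic_approx`). A test function supported in one block with zero trace has neither jumps
nor flux, so `u_2` solves a local Dirichlet problem with load `f`; its residual satisfies `a(w, w) =
∫ f w`, and the gap with `κ ≥ 1` concludes (`exists_interior_approx`). The jump sum on the right
enters only as a nonnegative term.

An inverse constant valid for all `κ` comes from equivalence of forms in finite dimension at `κ =
1`, minimality of the energy of harmonic extensions, and `κ ≤ κ_K` (`exists_inverseConstant`). -/

namespace GMsDG

/-! ### Bilinear forms and spectral expansions in finite dimension. -/

section LinearAlgebra

variable {E : Type*} [AddCommGroup E] [Module ℝ E]

/-- Definiteness makes `B` injective into the dual, and equality of dimensions makes it onto.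
Harmonic extensions and fluxes are both obtained this way. -/
theorem exists_riesz [FiniteDimensional ℝ E] (B : E →ₗ[ℝ] E →ₗ[ℝ] ℝ)
    (hB : ∀ x, B x x = 0 → x = 0) (l : E →ₗ[ℝ] ℝ) : ∃ v, ∀ w, B v w = l w := by
  have hinj : Function.Injective B := by
    rw [injective_iff_map_eq_zero]
    intro x hx
    exact hB x (by rw [hx]; rfl)
  have hsurj : Function.Surjective B :=
    (LinearMap.injective_iff_surjective_of_finrank_eq_finrank
      (Subspace.dual_finrank_eq (K := ℝ) (V := E)).symm).1 hinj
  obtain ⟨v, hv⟩ := hsurj l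
  exact ⟨v, fun w => by rw [hv]⟩

theorem exists_sq_le_of_definite [FiniteDimensional ℝ E] (B : E →ₗ[ℝ] E →ₗ[ℝ] ℝ)
    (hsymm : ∀ x y, B x y = B y x) (hnonneg : ∀ x, 0 ≤ B x x)
    (hB : ∀ x, B x x = 0 → x = 0) (l : E →ₗ[ℝ] ℝ) :
    ∃ c : ℝ, 0 ≤ c ∧ ∀ x, l x ^ 2 ≤ c * B x x := by
  obtain ⟨v, hv⟩ := exists_riesz B hB l
  refine ⟨B v v, hnonneg v, fun x => ?_⟩
  rw [← hv x]
  -- Nonnegativity of `B` at `v + t x` is a quadratic inequality in `t`; its discriminant is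
  -- Cauchy–Schwarz, with constant `B v v`.
  have key : ∀ t : ℝ, 0 ≤ B x x * (t * t) + (2 * B v x) * t + B v v := by
    intro t
    have h := hnonneg (v + t • x)
    simp only [map_add, map_smul, LinearMap.add_apply, LinearMap.smul_apply, smul_eq_mul,
      hsymm x v] at h
    linarith
  have := discrim_le_zero key
  rw [discrim] at this
  nlinarith

/-- In coordinates `D x x` is a sum of products of two linear functionals, and the square of each is
at most a multiple of `B x x`. -/
theorem exists_form_le_of_definite [FiniteDimensional ℝ E] (B D : E →ₗ[ℝ] E →ₗ[ℝ] ℝ)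
    (hsymm : ∀ x y, B x y = B y x) (hnonneg : ∀ x, 0 ≤ B x x)
    (hB : ∀ x, B x x = 0 → x = 0) : ∃ c : ℝ, 0 ≤ c ∧ ∀ x, D x x ≤ c * B x x := by
  let b := Module.finBasis ℝ E
  choose c hc0 hc using fun i => exists_sq_le_of_definite B hsymm hnonneg hB (b.coord i)
  choose d hd0 hd using fun i => exists_sq_le_of_definite B hsymm hnonneg hB (D (b i))
  refine ⟨∑ i, (c i + d i), Finset.sum_nonneg fun i _ => add_nonneg (hc0 i) (hd0 i),
    fun x => ?_⟩
  have h0 : D x = ∑ i, b.coord i x • D (b i) := by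
    conv_lhs => rw [← b.sum_repr x]
    simp only [map_sum, map_smul, b.coord_apply]
  have hx : D x x = ∑ i, b.coord i x * D (b i) x := by
    conv_lhs => rw [h0]
    simp only [LinearMap.sum_apply, LinearMap.smul_apply, smul_eq_mul]
  rw [hx, Finset.sum_mul]
  refine Finset.sum_le_sum fun i _ => ?_
  nlinarith [hc i x, hd i x, sq_nonneg (b.coord i x - D (b i) x), sq_nonneg (b.coord i x),
    sq_nonneg (D (b i) x)]

/-- Distinct eigenvalues make the eigenvectors `m`-orthogonal, so there are enough of them to form a
basis. The witness `v` is the truncated expansion of `u`; both forms are diagonal, and the residual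
sees only eigenvalues from `lam (l + 1)` on. -/
theorem exists_eigen_projection [FiniteDimensional ℝ E] (a m : E →ₗ[ℝ] E →ₗ[ℝ] ℝ)
    (ha : ∀ x y, a x y = a y x) (hm : ∀ x y, m x y = m y x) (hpos : ∀ x, x ≠ 0 → 0 < m x x)
    (φ : ℕ → E) (lam : ℕ → ℝ)
    (hne : ∀ k ∈ Set.Icc 1 (Module.finrank ℝ E), φ k ≠ 0)
    (heig : ∀ k ∈ Set.Icc 1 (Module.finrank ℝ E), ∀ v, a (φ k) v = lam k * m (φ k) v)
    (hlam : StrictMonoOn lam (Set.Icc 1 (Module.finrank ℝ E)))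
    (l : ℕ) (u : E) :
    ∃ v ∈ Submodule.span ℝ (φ '' Set.Icc 1 l), a v (u - v) = 0 ∧
      (l = Module.finrank ℝ E → u - v = 0) ∧
      (l < Module.finrank ℝ E → lam (l + 1) * m (u - v) (u - v) ≤ a (u - v) (u - v)) := by
  classical
  set M := Module.finrank ℝ E with hM
  -- Because of the shift, `i < l` selects exactly `φ 1, …, φ l`.
  let ψ : Fin M → E := fun i => φ (i + 1)
  have hmem : ∀ i : Fin M, (i : ℕ) + 1 ∈ Set.Icc 1 M := fun i => ⟨by omega, by omega⟩
  have horth : ∀ i j : Fin M, i ≠ j → m (ψ i) (ψ j) = 0 := by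
    intro i j hij
    have h1 := heig _ (hmem i) (ψ j)
    have h2 := heig _ (hmem j) (ψ i)
    have h3 : lam (i + 1) * m (ψ i) (ψ j) = lam (j + 1) * m (ψ i) (ψ j) := by
      rw [← h1, ha, h2, hm (φ _)]
    have h4 : lam ((i : ℕ) + 1) ≠ lam ((j : ℕ) + 1) := fun h =>
      hij (Fin.ext (by have := hlam.injOn (hmem i) (hmem j) h; omega))
    by_contra h5
    exact h4 (mul_right_cancel₀ h5 h3)
  have hli : LinearIndependent ℝ ψ := by
    refine LinearMap.linearIndependent_of_isOrthoᵢ (B := m) (fun i j hij => horth i j hij) ?_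
    intro i hi
    exact (hpos _ (hne _ (hmem i))).ne' hi
  let b := Module.Basis.mk hli
    (hli.span_eq_top_of_card_eq_finrank' (by rw [Fintype.card_fin])).ge
  have hb : ∀ i, b i = ψ i := fun i => by simp [b]
  let c := b.repr u
  have hu : u = ∑ i, c i • ψ i := by
    conv_lhs => rw [← b.sum_repr u]
    simp only [hb, c]
  let v := ∑ i ∈ Finset.univ.filter (fun i : Fin M => (i : ℕ) < l), c i • ψ i
  have hw : u - v = ∑ i ∈ Finset.univ.filter (fun i : Fin M => ¬ (i : ℕ) < l), c i • ψ i := by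
    rw [sub_eq_iff_eq_add', hu, Finset.sum_filter_add_sum_filter_not]
  have hmψ : ∀ (s : Finset (Fin M)) (i : Fin M),
      m (ψ i) (∑ j ∈ s, c j • ψ j) = if i ∈ s then c i * m (ψ i) (ψ i) else 0 := by
    intro s i
    rw [map_sum, ← Finset.sum_ite_eq s i (fun j => c j * m (ψ i) (ψ j))]
    refine Finset.sum_congr rfl fun j _ => ?_
    split_ifs with h
    · simp
    · simp [horth i j h]
  have hB : ∀ (B : E →ₗ[ℝ] E →ₗ[ℝ] ℝ) (s : Finset (Fin M)) (y : E),
      B (∑ i ∈ s, c i • ψ i) y = ∑ i ∈ s, c i * B (ψ i) y := fun B s y => by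
    simp only [map_sum, map_smul, LinearMap.sum_apply, LinearMap.smul_apply, smul_eq_mul]
  refine ⟨v, ?_, ?_, ?_, ?_⟩
  · refine Submodule.sum_mem _ fun i hi => Submodule.smul_mem _ _ (Submodule.subset_span ?_)
    rw [Finset.mem_filter] at hi
    exact ⟨i + 1, ⟨by omega, by omega⟩, rfl⟩
  · rw [hw, hB]
    refine Finset.sum_eq_zero fun i hi => ?_
    rw [heig _ (hmem i), hmψ, if_neg, mul_zero, mul_zero]
    simpa using hi
  · intro h
    rw [hw, Finset.filter_false_of_mem, Finset.sum_empty]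
    intro i _
    have := i.2
    omega
  · intro h
    rw [hw]
    set s := Finset.univ.filter fun i : Fin M => ¬ (i : ℕ) < l with hs
    rw [hB a, hB m, Finset.mul_sum]
    refine Finset.sum_le_sum fun i hi => ?_
    rw [heig _ (hmem i), hmψ, if_pos hi]
    have h1 : lam (l + 1) ≤ lam (i + 1) := by
      refine hlam.monotoneOn ⟨by omega, by omega⟩ (hmem i) ?_
      have := (Finset.mem_filter.1 hi).2
      omega
    have h2 := (hpos _ (hne _ (hmem i))).le
    have h3 : 0 ≤ c i * (c i * m (ψ i) (ψ i)) := by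
      rw [← mul_assoc]; exact mul_nonneg (mul_self_nonneg _) h2
    nlinarith [mul_le_mul_of_nonneg_right h1 h3]

end LinearAlgebra

/-! ### Convex polygons, their edges, and integration over edges. -/

section Geometry

theorem isCompact_poly (K : Finset Plane) : IsCompact (poly K) :=
  K.finite_toSet.isCompact_convexHull ℝ

theorem measurableSet_poly (K : Finset Plane) : MeasurableSet (poly K) :=
  (isCompact_poly K).measurableSet

theorem one_lt_rank_plane : 1 < Module.rank ℝ Plane := by
  rw [← Module.finrank_eq_rank, finrank_euclideanSpace_fin]
  norm_num

/-- Otherwise the interior and the complement of the polygon would separate the plane minus finitely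
many points, which is connected. -/
theorem exists_mem_frontier_notMem (K : Finset Plane) (hK : (interior (poly K)).Nonempty) :
    ∃ x ∈ frontier (poly K), x ∉ K := by
  by_contra! h
  have hclosed := (isCompact_poly K).isClosed
  have hconn : IsPreconnected ((K : Set Plane)ᶜ) :=
    (K.finite_toSet.countable.isConnected_compl_of_one_lt_rank one_lt_rank_plane).isPreconnected
  have hne : (poly K)ᶜ.Nonempty := by
    rw [Set.nonempty_compl]
    intro hu
    exact (NormedSpace.unbounded_univ ℝ Plane) (hu ▸ (isCompact_poly K).isBounded)
  obtain ⟨y, hy⟩ := hne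
  obtain ⟨x, hx, hxK⟩ := (K.finite_toSet.countable.dense_compl ℝ).inter_open_nonempty _
    isOpen_interior hK
  obtain ⟨z, -, hz1, hz2⟩ := hconn _ _ isOpen_interior hclosed.isOpen_compl
    (fun z hz => by
      by_cases hzK : z ∈ poly K
      · left
        by_contra hzi
        exact hz (h z (by rw [hclosed.frontier_eq]; exact ⟨hzK, hzi⟩))
      · right; exact hzK)
    ⟨x, hxK, hx⟩ ⟨y, fun hyK => hy (subset_convexHull ℝ _ hyK), hy⟩
  exact hz2 (interior_subset hz1)

/-- A convex combination at which `f` reaches its maximum over the vertices gives no weight to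
vertices below the maximum. -/
theorem mem_convexHull_face {K : Finset Plane} (f : Plane →L[ℝ] ℝ) {x : Plane}
    (hx : x ∈ poly K) (hf : ∀ y ∈ K, f y ≤ f x) :
    x ∈ convexHull ℝ {y | y ∈ K ∧ f y = f x} := by
  obtain ⟨w, hw0, hw1, hwx⟩ := Finset.mem_convexHull'.1 hx
  have hsum : ∑ y ∈ K, w y * (f x - f y) = 0 := by
    have : f x = ∑ y ∈ K, w y * f y := by
      conv_lhs => rw [← hwx]
      simp
    simp only [mul_sub, Finset.sum_sub_distrib, ← Finset.sum_mul, hw1, ← this]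
    ring
  have hz := (Finset.sum_eq_zero_iff_of_nonneg
    fun y hy => mul_nonneg (hw0 y hy) (sub_nonneg.2 (hf y hy))).1 hsum
  have hcm : K.centerMass w id = x := by
    rw [Finset.centerMass_eq_of_sum_1 _ _ hw1]; simpa using hwx
  rw [← hcm, ← Finset.centerMass_filter_ne_zero]
  refine Finset.centerMass_mem_convexHull _ (fun y hy => hw0 y (Finset.mem_filter.1 hy).1) ?_ ?_
  · rw [Finset.sum_filter_ne_zero, hw1]; norm_num
  · intro y hy
    rw [Finset.mem_filter] at hy
    refine ⟨hy.1, ?_⟩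
    rcases mul_eq_zero.1 (hz y hy.1) with h | h
    · exact absurd h hy.2
    · rw [Finset.centerMass_filter_ne_zero, hcm]
      exact (sub_eq_zero.1 h).symm

/-- A supporting line at a boundary point that is not a vertex exposes a face containing that point,
hence two vertices; the segment between them stays on the supporting line. This keeps `bdry K`
nonempty and `cellKappa` positive. -/
theorem cellEdges_nonempty (K : Finset Plane) (hK : (interior (poly K)).Nonempty) :
    (cellEdges K).Nonempty := by
  classical
  obtain ⟨x, hxf, hxK⟩ := exists_mem_frontier_notMem K hK
  have hclosed := (isCompact_poly K).isClosed
  have hconv : Convex ℝ (poly K) := convex_convexHull ℝ _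
  rw [hclosed.frontier_eq] at hxf
  obtain ⟨f, hf⟩ := geometric_hahn_banach_open_point hconv.interior isOpen_interior hxf.2
  have hle : ∀ y ∈ poly K, f y ≤ f x := by
    intro y hy
    have : y ∈ closure (interior (poly K)) := by
      rw [hconv.closure_interior_eq_closure_of_nonempty_interior hK]
      exact subset_closure hy
    exact closure_minimal (fun z hz => (hf z hz).le)
      (isClosed_le f.continuous continuous_const) this
  have hx := mem_convexHull_face f hxf.1 fun y hy => hle y (subset_convexHull ℝ _ hy)
  have hnt : {y | y ∈ K ∧ f y = f x}.Nontrivial := by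
    rw [← Set.not_subsingleton_iff]
    intro hs
    rcases hs.eq_empty_or_singleton with h | ⟨y, h⟩
    · rw [h, convexHull_empty] at hx; exact hx
    · have hy : y ∈ {y | y ∈ K ∧ f y = f x} := by rw [h]; rfl
      rw [h, convexHull_singleton] at hx
      exact hxK ((Set.mem_singleton_iff.1 hx) ▸ hy.1)
  obtain ⟨p, hp, q, hq, hpq⟩ := hnt
  refine ⟨{p, q}, ?_⟩
  rw [cellEdges, Finset.mem_filter, Finset.mem_powersetCard]
  have hsub : ({p, q} : Finset Plane) ⊆ K := by
    intro z hz
    rcases Finset.mem_insert.1 hz with rfl | hz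
    · exact hp.1
    · rw [Finset.mem_singleton.1 hz]; exact hq.1
  refine ⟨⟨hsub, Finset.card_pair hpq⟩, fun z hz => ?_⟩
  rw [hclosed.frontier_eq]
  refine ⟨convexHull_mono (by exact_mod_cast hsub) hz, fun hzi => ?_⟩
  have hzf : z ∈ {z | f z = f x} := by
    refine convexHull_min ?_ (convex_hyperplane f.toLinearMap.isLinear (f x)) hz
    intro y hy
    simp only [Finset.coe_insert, Finset.coe_singleton] at hy
    rcases hy with rfl | hy
    · exact hp.2
    · rw [Set.mem_singleton_iff.1 hy]; exact hq.2
  exact (hf z hzi).ne hzf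

theorem exists_segment_of_mem_cellEdges {K e : Finset Plane} (he : e ∈ cellEdges K) :
    ∃ p q, p ≠ q ∧ poly e = segment ℝ p q := by
  classical
  rw [cellEdges, Finset.mem_filter, Finset.mem_powersetCard] at he
  obtain ⟨p, q, hpq, rfl⟩ := Finset.card_eq_two.1 he.1.2
  exact ⟨p, q, hpq, by simp [poly, convexHull_pair]⟩

theorem poly_edge_subset {K e : Finset Plane} (he : e ∈ cellEdges K) : poly e ⊆ poly K := by
  classical
  rw [cellEdges, Finset.mem_filter, Finset.mem_powersetCard] at he
  exact convexHull_mono (by exact_mod_cast he.1.1)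

theorem poly_edge_subset_bdry {K e : Finset Plane} (he : e ∈ cellEdges K) : poly e ⊆ bdry K :=
  Set.subset_biUnion_of_mem (u := fun e => poly e) he

theorem bdry_subset_poly (K : Finset Plane) : bdry K ⊆ poly K :=
  Set.iUnion₂_subset fun _ he => poly_edge_subset he

theorem hausdorffMeasure_edge_lt_top {K e : Finset Plane} (he : e ∈ cellEdges K) :
    μH[1] (poly e) < ⊤ := by
  obtain ⟨p, q, -, h⟩ := exists_segment_of_mem_cellEdges he
  rw [h, hausdorffMeasure_segment]
  exact edist_lt_top _ _

theorem integrableOn_edge {K e : Finset Plane} (he : e ∈ cellEdges K) {g : Plane → ℝ}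
    (hg : ContinuousOn g (poly e)) : IntegrableOn g (poly e) μH[1] := by
  obtain ⟨C, hC⟩ := (isCompact_poly e).exists_bound_of_continuousOn hg
  refine IntegrableOn.of_bound (hausdorffMeasure_edge_lt_top he)
    (hg.aestronglyMeasurable (measurableSet_poly e)) C ?_
  exact (ae_restrict_iff' (measurableSet_poly e)).2 (Filter.Eventually.of_forall hC)

/-- A nonzero value would persist by continuity on a subsegment, which has positive length. This
makes the boundary form definite on traces. -/
theorem eq_zero_of_edgeIntegral_sq {K e : Finset Plane} (he : e ∈ cellEdges K) {g : Plane → ℝ}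
    (hg : ContinuousOn g (poly e)) (h : edgeIntegral e (fun x => g x ^ 2) = 0) :
    ∀ x ∈ poly e, g x = 0 := by
  have hae : (fun x => g x ^ 2) =ᵐ[μH[1].restrict (poly e)] 0 :=
    (integral_eq_zero_iff_of_nonneg (fun x => sq_nonneg _) (integrableOn_edge he (hg.pow 2))).1 h
  have hnull : μH[1] {x | x ∈ poly e ∧ g x ≠ 0} = 0 := by
    have := (ae_restrict_iff' (measurableSet_poly e)).1 hae
    rw [ae_iff] at this
    convert this using 3
    simp
  intro x hx
  by_contra hgx
  obtain ⟨p, q, hpq, hseg⟩ := exists_segment_of_mem_cellEdges he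
  -- The point `x` may be an endpoint, so the subsegment runs from `x` towards some other point of
  -- the edge.
  obtain ⟨r, hr, hrx⟩ : ∃ r ∈ poly e, r ≠ x := by
    by_cases hp : p = x
    · exact ⟨q, hseg ▸ right_mem_segment ℝ p q, fun h => hpq (hp.trans h.symm)⟩
    · exact ⟨p, hseg ▸ left_mem_segment ℝ p q, hp⟩
  have hconv : Convex ℝ (poly e) := convex_convexHull ℝ _
  obtain ⟨U, hU, hxU, hUg⟩ : ∃ U, IsOpen U ∧ x ∈ U ∧ ∀ y ∈ U ∩ poly e, g y ≠ 0 := by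
    have := (hg x hx).eventually_ne hgx
    obtain ⟨U, hU, hxU, h⟩ := mem_nhdsWithin.1 this
    exact ⟨U, hU, hxU, h⟩
  have hcont : Filter.Tendsto (fun t : ℝ => AffineMap.lineMap x r t) (nhdsWithin 0 (Set.Ioi 0))
      (nhds x) := by
    have : Continuous fun t : ℝ => (AffineMap.lineMap x r t : Plane) :=
      AffineMap.lineMap_continuous
    have h2 := this.tendsto 0
    simp only [AffineMap.lineMap_apply_zero] at h2
    exact h2.mono_left nhdsWithin_le_nhds
  obtain ⟨ε, hε, hball⟩ := Metric.isOpen_iff.1 hU x hxU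
  have hev := (hcont.eventually (Metric.ball_mem_nhds x hε)).and
    (Ioo_mem_nhdsGT (show (0 : ℝ) < 1 by norm_num))
  obtain ⟨t, htb, ht0, ht1⟩ := hev.exists
  set y : Plane := AffineMap.lineMap x r t with hy
  have hye : y ∈ poly e := hconv.lineMap_mem hx hr ⟨ht0.le, ht1.le⟩
  have hxy : x ≠ y := by
    intro h
    rw [hy, eq_comm, AffineMap.lineMap_eq_left_iff] at h
    rcases h with h | h
    · exact hrx h.symm
    · exact ht0.ne' h
  have hsub : segment ℝ x y ⊆ {x | x ∈ poly e ∧ g x ≠ 0} := by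
    intro z hz
    have hze := hconv.segment_subset hx hye hz
    exact ⟨hze, hUg z ⟨hball ((convex_ball x ε).segment_subset (Metric.mem_ball_self hε) htb hz),
      hze⟩⟩
  have := measure_mono_null hsub hnull
  rw [hausdorffMeasure_segment, edist_eq_zero] at this
  exact hxy this

end Geometry

noncomputable section

variable {G : Grids} {κ : Plane → ℝ} {K : Finset Plane}

/-! ### Fine triangles inside a coarse cell, and the mesh sizes. -/

section Mesh

open Classical in
/-- The fine triangles contained in a cell. -/
def fineIn (G : Grids) (K : Finset Plane) : Finset (Finset Plane) :=
  G.fine.cells.filter fun T => poly T ⊆ poly K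

theorem mem_fineIn {T : Finset Plane} :
    T ∈ fineIn G K ↔ T ∈ G.fine.cells ∧ poly T ⊆ poly K := by
  classical
  simp [fineIn]

theorem poly_eq_biUnion_fineIn (hK : K ∈ G.coarse.cells) :
    poly K = ⋃ T ∈ fineIn G K, poly T := by
  have := G.coarse_eq K hK
  simpa only [Set.mem_ofPred_eq, mem_fineIn] using this

theorem fineIn_nonempty (hK : K ∈ G.coarse.cells) : (fineIn G K).Nonempty := by
  obtain ⟨x, hx⟩ := (G.coarse.interior_nonempty K hK).mono interior_subset
  rw [poly_eq_biUnion_fineIn hK] at hx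
  simp only [Set.mem_iUnion] at hx
  obtain ⟨T, hT, -⟩ := hx
  exact ⟨T, hT⟩

theorem diam_poly_pos {T : Finset Plane} (hT : (interior (poly T)).Nonempty) :
    0 < Metric.diam (poly T) := by
  obtain ⟨x, hx⟩ := hT
  obtain ⟨ε, hε, hb⟩ := Metric.isOpen_iff.1 isOpen_interior x hx
  obtain ⟨y, hy⟩ := exists_norm_eq Plane (half_pos hε).le
  have hxy : x + y ∈ poly T := interior_subset (hb (by
    rw [Metric.mem_ball, dist_eq_norm, add_sub_cancel_left, hy]; linarith))
  have := Metric.dist_le_diam_of_mem (isCompact_poly T).isBounded (interior_subset hx) hxy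
  rw [dist_eq_norm, sub_add_cancel_left, norm_neg, hy] at this
  linarith

theorem PolyMesh.size_pos {M : PolyMesh} (h : M.cells.Nonempty) : 0 < M.size := by
  obtain ⟨T, hT⟩ := h
  refine (diam_poly_pos (M.interior_nonempty T hT)).trans_le (le_csSup ?_ ⟨T, hT, rfl⟩)
  exact (M.cells.finite_toSet.image _).bddAbove

theorem coarse_size_pos (hK : K ∈ G.coarse.cells) : 0 < G.coarse.size :=
  PolyMesh.size_pos ⟨K, hK⟩

theorem fine_size_pos (hK : K ∈ G.coarse.cells) : 0 < G.fine.size := by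
  obtain ⟨T, hT⟩ := fineIn_nonempty hK
  exact PolyMesh.size_pos ⟨T, (mem_fineIn.1 hT).1⟩

/-- Frontiers of convex sets are null, so the triangle boundaries, where gradients may fail to
exist, do not affect integrals. -/
theorem poly_ae_eq (hK : K ∈ G.coarse.cells) :
    poly K =ᵐ[volume] ⋃ T ∈ fineIn G K, interior (poly T) := by
  refine Filter.EventuallyLE.antisymm ?_ ?_
  · rw [poly_eq_biUnion_fineIn hK]
    have h : ∀ T ∈ fineIn G K, ∀ᵐ x ∂(volume : Measure Plane), x ∉ frontier (poly T) := by
      intro T _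
      rw [ae_iff]
      simpa using (convex_convexHull ℝ (T : Set Plane)).addHaar_frontier volume
    have h' : ∀ᵐ x ∂(volume : Measure Plane), ∀ T ∈ fineIn G K, x ∉ frontier (poly T) :=
      (ae_ball_iff (fineIn G K).countable_toSet).2 h
    filter_upwards [h'] with x hx
    intro hxT
    change x ∈ ⋃ T ∈ fineIn G K, poly T at hxT
    change x ∈ ⋃ T ∈ fineIn G K, interior (poly T)
    simp only [Set.mem_iUnion, exists_prop] at hxT ⊢
    obtain ⟨T, hT, hxT⟩ := hxT
    refine ⟨T, hT, ?_⟩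
    by_contra hi
    exact hx T hT (by rw [(isCompact_poly T).isClosed.frontier_eq]; exact ⟨hxT, hi⟩)
  · refine Filter.Eventually.of_forall fun x hx => ?_
    change x ∈ ⋃ T ∈ fineIn G K, interior (poly T) at hx
    change x ∈ poly K
    simp only [Set.mem_iUnion, exists_prop] at hx
    obtain ⟨T, hT, hx⟩ := hx
    exact (mem_fineIn.1 hT).2 (interior_subset hx)

theorem setIntegral_poly_eq_sum (hK : K ∈ G.coarse.cells) {g : Plane → ℝ}
    (hg : ∀ T ∈ fineIn G K, IntegrableOn g (interior (poly T))) :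
    ∫ x in poly K, g x = ∑ T ∈ fineIn G K, ∫ x in interior (poly T), g x := by
  rw [setIntegral_congr_set (poly_ae_eq hK)]
  refine integral_biUnion_finset _ (fun T _ => isOpen_interior.measurableSet) ?_ hg
  intro S hS T hT hST
  exact G.fine.disjoint_interior S (mem_fineIn.1 hS).1 T (mem_fineIn.1 hT).1 hST

end Mesh

/-! ### Bounds and integrability of the coefficient on a cell. -/

section Coefficient

theorem poly_subset_region (hK : K ∈ G.coarse.cells) : poly K ⊆ G.coarse.region :=
  Set.subset_biUnion_of_mem (u := fun K => poly K) hK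

theorem IsCoefficient.aemeasurable_poly (hκ : IsCoefficient G κ) (hK : K ∈ G.coarse.cells) :
    AEMeasurable κ (volume.restrict (poly K)) :=
  hκ.aemeasurable.mono_measure (Measure.restrict_mono (poly_subset_region hK) le_rfl)

theorem IsCoefficient.one_le_poly (hκ : IsCoefficient G κ) (hK : K ∈ G.coarse.cells) :
    ∀ᵐ x ∂(volume.restrict (poly K)), 1 ≤ κ x :=
  ae_mono (Measure.restrict_mono (poly_subset_region hK) le_rfl) hκ.one_le

theorem IsCoefficient.bounded_poly (hκ : IsCoefficient G κ) (hK : K ∈ G.coarse.cells) :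
    ∃ B, ∀ᵐ x ∂(volume.restrict (poly K)), κ x ≤ B := by
  obtain ⟨B, hB⟩ := hκ.bounded
  exact ⟨B, ae_mono (Measure.restrict_mono (poly_subset_region hK) le_rfl) hB⟩

theorem volume_poly_lt_top (K : Finset Plane) : volume (poly K) < ⊤ :=
  (isCompact_poly K).measure_lt_top

theorem IsCoefficient.le_cellMax (hκ : IsCoefficient G κ) (hK : K ∈ G.coarse.cells) :
    ∀ᵐ x ∂(volume.restrict (poly K)), κ x ≤ cellMax κ K := by
  obtain ⟨B, hB⟩ := hκ.bounded_poly hK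
  exact ae_le_essSup ⟨B, hB⟩

theorem IsCoefficient.one_le_cellMax (hκ : IsCoefficient G κ) (hK : K ∈ G.coarse.cells) :
    1 ≤ cellMax κ K := by
  have hpos : 0 < volume (poly K) :=
    (isOpen_interior.measure_pos _ (G.coarse.interior_nonempty K hK)).trans_le
      (measure_mono interior_subset)
  have : (ae (volume.restrict (poly K))).NeBot :=
    ae_neBot.2 fun h => hpos.ne' (Measure.restrict_eq_zero.1 h)
  obtain ⟨x, h1, h2⟩ := ((hκ.one_le_poly hK).and (hκ.le_cellMax hK)).exists
  exact h1.trans h2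

theorem IsCoefficient.integrableOn_mul (hκ : IsCoefficient G κ) (hK : K ∈ G.coarse.cells)
    {g : Plane → ℝ} (hg : IntegrableOn g (poly K)) :
    IntegrableOn (fun x => κ x * g x) (poly K) := by
  refine Integrable.bdd_mul (c := cellMax κ K) hg (hκ.aemeasurable_poly hK).aestronglyMeasurable ?_
  filter_upwards [hκ.one_le_poly hK, hκ.le_cellMax hK] with x h1 h2
  rw [Real.norm_eq_abs, abs_of_nonneg (by linarith)]
  exact h2

theorem IsCoefficient.integrableOn (hκ : IsCoefficient G κ) (hK : K ∈ G.coarse.cells) :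
    IntegrableOn κ (poly K) := by
  have := hκ.integrableOn_mul hK (g := fun _ => 1)
    (integrableOn_const (volume_poly_lt_top K).ne)
  simpa using this

theorem isCoefficient_one (G : Grids) : IsCoefficient G (fun _ => 1) where
  aemeasurable := aemeasurable_const
  one_le := Filter.Eventually.of_forall fun _ => le_rfl
  bounded := ⟨1, Filter.Eventually.of_forall fun _ => le_rfl⟩

/-- The integral of the coefficient over a fine triangle. -/
def triangleWeight (κ : Plane → ℝ) (T : Finset Plane) : ℝ := ∫ x in interior (poly T), κ x

theorem interior_fine_subset {T : Finset Plane} (hT : T ∈ fineIn G K) :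
    interior (poly T) ⊆ poly K :=
  interior_subset.trans (mem_fineIn.1 hT).2

theorem triangleWeight_one_pos {T : Finset Plane} (hT : T ∈ fineIn G K) :
    0 < triangleWeight (fun _ => 1) T := by
  have h := isOpen_interior.measure_pos (volume : Measure Plane)
    (G.fine.interior_nonempty T (mem_fineIn.1 hT).1)
  have h' : volume (interior (poly T)) ≠ ⊤ :=
    ((measure_mono interior_subset).trans_lt (volume_poly_lt_top T)).ne
  simpa [triangleWeight, Measure.real] using ENNReal.toReal_pos h.ne' h'

theorem IsCoefficient.triangleWeight_bounds (hκ : IsCoefficient G κ) (hK : K ∈ G.coarse.cells)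
    {T : Finset Plane} (hT : T ∈ fineIn G K) :
    triangleWeight (fun _ => 1) T ≤ triangleWeight κ T ∧
      triangleWeight κ T ≤ cellMax κ K * triangleWeight (fun _ => 1) T := by
  have hsub := interior_fine_subset hT
  have hae {p : Plane → Prop} (h : ∀ᵐ x ∂(volume.restrict (poly K)), p x) :
      ∀ᵐ x ∂(volume.restrict (interior (poly T))), p x :=
    ae_mono (Measure.restrict_mono hsub le_rfl) h
  have h1 : IntegrableOn (fun _ : Plane => (1 : ℝ)) (interior (poly T)) :=
    ((isCoefficient_one G).integrableOn hK).mono_set hsub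
  have h2 := (hκ.integrableOn hK).mono_set hsub
  refine ⟨setIntegral_mono_ae_restrict h1 h2 (hae (hκ.one_le_poly hK)), ?_⟩
  rw [triangleWeight, triangleWeight, ← integral_const_mul]
  exact setIntegral_mono_ae_restrict h2 (h1.const_mul _) (by
    filter_upwards [hae (hκ.le_cellMax hK)] with x hx
    simpa using hx)

end Coefficient

/-! ### Piecewise constant gradients and the energy as a bilinear form. -/

section Gradient

open Classical in
/-- A point in the interior of a polygon. -/
def center (T : Finset Plane) : Plane :=
  if h : (interior (poly T)).Nonempty then h.some else 0

theorem center_mem {T : Finset Plane} (hT : T ∈ fineIn G K) : center T ∈ interior (poly T) := by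
  have h := G.fine.interior_nonempty T (mem_fineIn.1 hT).1
  rw [center, dif_pos h]
  exact h.some_mem

theorem exists_hasGradientAt {v : Plane → ℝ} (hv : v ∈ Vh G K) {T : Finset Plane}
    (hT : T ∈ fineIn G K) : ∃ d : Plane, (∀ x ∈ interior (poly T), HasGradientAt v d x) ∧
      ∀ x ∈ poly T, ∀ y ∈ poly T, v x - v y = inner ℝ d (x - y) := by
  obtain ⟨A, hA⟩ := hv.2.2 T (mem_fineIn.1 hT).1 (mem_fineIn.1 hT).2
  let l : Plane →L[ℝ] ℝ := A.linear.toContinuousLinearMap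
  refine ⟨(InnerProductSpace.toDual ℝ Plane).symm l, fun x hx => ?_, fun x hx y hy => ?_⟩
  · rw [hasGradientAt_iff_hasFDerivAt, LinearIsometryEquiv.apply_symm_apply]
    have h : HasFDerivAt (fun y => l y + A 0) l x := l.hasFDerivAt.add_const _
    refine h.congr_of_eventuallyEq ?_
    filter_upwards [isOpen_interior.mem_nhds hx] with y hy
    rw [hA (interior_subset hy)]
    exact congrFun A.decomp y
  · rw [hA hx, hA hy, InnerProductSpace.toDual_symm_apply, ← vsub_eq_sub, ← A.linearMap_vsub]
    rfl

theorem gradient_eq_center {v : Plane → ℝ} (hv : v ∈ Vh G K) {T : Finset Plane}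
    (hT : T ∈ fineIn G K) {x : Plane} (hx : x ∈ interior (poly T)) :
    gradient v x = gradient v (center T) := by
  obtain ⟨d, hd, -⟩ := exists_hasGradientAt hv hT
  rw [(hd x hx).gradient, (hd _ (center_mem hT)).gradient]

theorem sub_eq_inner_gradient {v : Plane → ℝ} (hv : v ∈ Vh G K) {T : Finset Plane}
    (hT : T ∈ fineIn G K) {x y : Plane} (hx : x ∈ poly T) (hy : y ∈ poly T) :
    v x - v y = inner ℝ (gradient v (center T)) (x - y) := by
  obtain ⟨d, hd, h⟩ := exists_hasGradientAt hv hT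
  rw [(hd _ (center_mem hT)).gradient, h x hx y hy]

open Classical in
/-- The gradient on a fine triangle as a linear map. -/
def gradOn (G : Grids) (K T : Finset Plane) : Vh G K →ₗ[ℝ] Plane where
  -- Outside `fineIn G K` nothing makes `gradient` additive, hence the default 0.
  toFun u := if T ∈ fineIn G K then gradient u.1 (center T) else 0
  map_add' u v := by
    split_ifs with hT
    · obtain ⟨d, hd, -⟩ := exists_hasGradientAt u.2 hT
      obtain ⟨d', hd', -⟩ := exists_hasGradientAt v.2 hT
      have h := (hd _ (center_mem hT)).hasFDerivAt.add (hd' _ (center_mem hT)).hasFDerivAt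
      rw [(hd _ (center_mem hT)).gradient, (hd' _ (center_mem hT)).gradient]
      rw [← map_add] at h
      exact (hasGradientAt_iff_hasFDerivAt.2 h).gradient
    · simp
  map_smul' c u := by
    split_ifs with hT
    · obtain ⟨d, hd, -⟩ := exists_hasGradientAt u.2 hT
      have h := (hd _ (center_mem hT)).hasFDerivAt.const_smul c
      rw [(hd _ (center_mem hT)).gradient]
      have e : c • (InnerProductSpace.toDual ℝ Plane) d
          = (InnerProductSpace.toDual ℝ Plane) (c • d) := by simp
      rw [e] at h
      exact (hasGradientAt_iff_hasFDerivAt.2 h).gradient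
    · simp

theorem gradOn_apply {T : Finset Plane} (hT : T ∈ fineIn G K) (u : Vh G K) :
    gradOn G K T u = gradient u.1 (center T) := by
  simp [gradOn, hT]

/-- The energy form on the fine space as a bilinear map. -/
def energyForm (G : Grids) (κ : Plane → ℝ) (K : Finset Plane) :
    Vh G K →ₗ[ℝ] Vh G K →ₗ[ℝ] ℝ :=
  ∑ T ∈ fineIn G K, triangleWeight κ T •
    (innerₗ Plane).compl₁₂ (gradOn G K T) (gradOn G K T)

theorem energyForm_apply (u v : Vh G K) : energyForm G κ K u v =
    ∑ T ∈ fineIn G K, triangleWeight κ T * inner ℝ (gradOn G K T u) (gradOn G K T v) := by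
  simp [energyForm, LinearMap.sum_apply]

/-- Gradients are constant on each fine triangle, so `κ` matters only through its integral over each
of them. This replaces the integral by a bilinear map to which linear algebra applies. -/
theorem energy_eq_energyForm (hκ : IsCoefficient G κ) (hK : K ∈ G.coarse.cells) (u v : Vh G K) :
    energy κ K u v = energyForm G κ K u v := by
  have hcongr : ∀ T ∈ fineIn G K, Set.EqOn
      (fun x => κ x * inner ℝ (gradient u.1 x) (gradient v.1 x))
      (fun x => κ x * inner ℝ (gradOn G K T u) (gradOn G K T v)) (interior (poly T)) := by
    intro T hT x hx
    simp only [gradOn_apply hT, gradient_eq_center u.2 hT hx, gradient_eq_center v.2 hT hx]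
  rw [energyForm_apply, energy, setIntegral_poly_eq_sum hK]
  · refine Finset.sum_congr rfl fun T hT => ?_
    rw [setIntegral_congr_fun isOpen_interior.measurableSet (hcongr T hT), integral_mul_const,
      triangleWeight]
  · intro T hT
    refine IntegrableOn.congr_fun ?_ (hcongr T hT).symm isOpen_interior.measurableSet
    exact ((hκ.integrableOn hK).mono_set (interior_fine_subset hT)).mul_const _

theorem energyForm_symm (u v : Vh G K) : energyForm G κ K u v = energyForm G κ K v u := by
  simp only [energyForm_apply, real_inner_comm]

theorem energyForm_one_nonneg (u : Vh G K) : 0 ≤ energyForm G (fun _ => 1) K u u := by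
  rw [energyForm_apply]
  exact Finset.sum_nonneg fun T hT =>
    mul_nonneg (triangleWeight_one_pos hT).le real_inner_self_nonneg

theorem energyForm_one_le (hκ : IsCoefficient G κ) (hK : K ∈ G.coarse.cells) (u : Vh G K) :
    energyForm G (fun _ => 1) K u u ≤ energyForm G κ K u u := by
  rw [energyForm_apply, energyForm_apply]
  exact Finset.sum_le_sum fun T hT =>
    mul_le_mul_of_nonneg_right (hκ.triangleWeight_bounds hK hT).1 real_inner_self_nonneg

theorem energyForm_le_one (hκ : IsCoefficient G κ) (hK : K ∈ G.coarse.cells) (u : Vh G K) :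
    energyForm G κ K u u ≤ cellMax κ K * energyForm G (fun _ => 1) K u u := by
  rw [energyForm_apply, energyForm_apply, Finset.mul_sum]
  refine Finset.sum_le_sum fun T hT => ?_
  rw [← mul_assoc]
  exact mul_le_mul_of_nonneg_right (hκ.triangleWeight_bounds hK hT).2 real_inner_self_nonneg

theorem energyForm_nonneg (hκ : IsCoefficient G κ) (hK : K ∈ G.coarse.cells) (u : Vh G K) :
    0 ≤ energyForm G κ K u u :=
  (energyForm_one_nonneg u).trans (energyForm_one_le hκ hK u)

/-- Vanishing gradients leave one value per triangle, so the continuous image of the connected cell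
is finite and connected, that is, a point. No adjacency between triangles has to be discussed. -/
theorem eq_of_energyForm_eq_zero (hκ : IsCoefficient G κ) (hK : K ∈ G.coarse.cells) {u : Vh G K}
    (hu : energyForm G κ K u u = 0) : ∀ x ∈ poly K, ∀ y ∈ poly K, u.1 x = u.1 y := by
  have h0 : energyForm G (fun _ => 1) K u u = 0 :=
    le_antisymm (hu ▸ energyForm_one_le hκ hK u) (energyForm_one_nonneg u)
  rw [energyForm_apply, Finset.sum_eq_zero_iff_of_nonneg fun T hT =>
    mul_nonneg (triangleWeight_one_pos hT).le real_inner_self_nonneg] at h0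
  have hconst : ∀ T ∈ fineIn G K, ∀ x ∈ poly T, u.1 x = u.1 (center T) := by
    intro T hT x hx
    have hg := (mul_eq_zero.1 (h0 T hT)).resolve_left (triangleWeight_one_pos hT).ne'
    rw [inner_self_eq_zero, gradOn_apply hT] at hg
    have := sub_eq_inner_gradient u.2 hT hx (interior_subset (center_mem hT))
    rw [hg, inner_zero_left] at this
    linarith
  have hfin : (u.1 '' poly K).Finite := by
    refine ((fineIn G K).finite_toSet.image fun T => u.1 (center T)).subset ?_
    rintro _ ⟨x, hx, rfl⟩
    rw [poly_eq_biUnion_fineIn hK] at hx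
    simp only [Set.mem_iUnion] at hx
    obtain ⟨T, hT, hx⟩ := hx
    exact ⟨T, hT, (hconst T hT x hx).symm⟩
  have hsub := hfin.countable.isTotallyDisconnected _ subset_rfl
    ((convex_convexHull ℝ (K : Set Plane)).isPreconnected.image u.1 u.2.2.1)
  exact fun x hx y hy => hsub ⟨x, hx, rfl⟩ ⟨y, hy, rfl⟩

end Gradient

/-! ### Finite dimension of the local spaces. -/

section FiniteDimension

/-- A function in `Vh` is determined by its values at the vertices of the fine triangles. -/
theorem finiteDimensional_Vh (hK : K ∈ G.coarse.cells) : FiniteDimensional ℝ (Vh G K) := by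
  classical
  let S : Finset Plane := (fineIn G K).biUnion id
  let F : Vh G K →ₗ[ℝ] (S → ℝ) :=
    { toFun := fun v x => v.1 x
      map_add' := fun _ _ => rfl
      map_smul' := fun _ _ => rfl }
  refine Module.Finite.of_injective F ((injective_iff_map_eq_zero F).2 fun v hv => ?_)
  refine Subtype.ext (funext fun x => ?_)
  by_cases hx : x ∈ poly K
  · rw [poly_eq_biUnion_fineIn hK] at hx
    simp only [Set.mem_iUnion] at hx
    obtain ⟨T, hT, hx⟩ := hx
    obtain ⟨A, hA⟩ := v.2.2.2 T (mem_fineIn.1 hT).1 (mem_fineIn.1 hT).2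
    have h0 : Set.EqOn A (0 : Plane →ᵃ[ℝ] ℝ) (T : Set Plane) := by
      intro y hy
      rw [← hA (subset_convexHull ℝ _ hy)]
      exact congrFun hv ⟨y, Finset.mem_biUnion.2 ⟨T, hT, hy⟩⟩
    rw [hA hx, AffineMap.eqOn_affineSpan h0 (convexHull_subset_affineSpan _ hx)]
    rfl
  · exact v.2.1 x hx

theorem Vh0_le_Vh (G : Grids) (K : Finset Plane) : Vh0 G K ≤ Vh G K := fun _ h => h.1

theorem finiteDimensional_Vh0 (hK : K ∈ G.coarse.cells) : FiniteDimensional ℝ (Vh0 G K) :=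
  haveI := finiteDimensional_Vh hK
  Submodule.finiteDimensional_of_le (Vh0_le_Vh G K)

end FiniteDimension

/-! ### The boundary `L²` form and its definiteness on traces. -/

section BoundaryForm

theorem continuousOn_edge {v : Plane → ℝ} (hv : v ∈ Vh G K) {e : Finset Plane}
    (he : e ∈ cellEdges K) : ContinuousOn v (poly e) := hv.2.1.mono (poly_edge_subset he)

theorem integrableOn_edge_mul {u v : Plane → ℝ} (hu : u ∈ Vh G K) (hv : v ∈ Vh G K)
    {e : Finset Plane} (he : e ∈ cellEdges K) :
    IntegrableOn (fun x => u x * v x) (poly e) μH[1] :=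
  integrableOn_edge he ((continuousOn_edge hu he).mul (continuousOn_edge hv he))

/-- The boundary `L²` form on the fine space as a bilinear map. -/
def bdryForm (G : Grids) (K : Finset Plane) : Vh G K →ₗ[ℝ] Vh G K →ₗ[ℝ] ℝ :=
  LinearMap.mk₂ ℝ (fun u v => bdryIntegral K fun x => u.1 x * v.1 x)
    (fun u u' v => by
      simp only [bdryIntegral, edgeIntegral, ← Finset.sum_add_distrib]
      refine Finset.sum_congr rfl fun e he => ?_
      rw [← integral_add (integrableOn_edge_mul u.2 v.2 he) (integrableOn_edge_mul u'.2 v.2 he)]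
      simp [add_mul])
    (fun c u v => by
      simp [bdryIntegral, edgeIntegral, Finset.mul_sum, ← integral_const_mul, mul_assoc])
    (fun u v v' => by
      simp only [bdryIntegral, edgeIntegral, ← Finset.sum_add_distrib]
      refine Finset.sum_congr rfl fun e he => ?_
      rw [← integral_add (integrableOn_edge_mul u.2 v.2 he) (integrableOn_edge_mul u.2 v'.2 he)]
      simp [mul_add])
    (fun c u v => by
      simp [bdryIntegral, edgeIntegral, Finset.mul_sum, ← integral_const_mul, mul_left_comm])

theorem bdryForm_apply (u v : Vh G K) :
    bdryForm G K u v = bdryIntegral K fun x => u.1 x * v.1 x := rfl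

theorem bdryForm_symm (u v : Vh G K) : bdryForm G K u v = bdryForm G K v u := by
  simp only [bdryForm_apply, mul_comm]

theorem bdryForm_nonneg (u : Vh G K) : 0 ≤ bdryForm G K u u :=
  Finset.sum_nonneg fun _ _ => integral_nonneg fun _ => mul_self_nonneg _

theorem bdryIntegral_congr {f g : Plane → ℝ} (h : ∀ x ∈ bdry K, f x = g x) :
    bdryIntegral K f = bdryIntegral K g :=
  Finset.sum_congr rfl fun e he => setIntegral_congr_fun (measurableSet_poly e)
    fun x hx => h x (poly_edge_subset_bdry he hx)

theorem eq_zero_of_bdryForm_eq_zero {u : Vh G K} (hu : bdryForm G K u u = 0) :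
    ∀ x ∈ bdry K, u.1 x = 0 := by
  have h := (Finset.sum_eq_zero_iff_of_nonneg fun e _ =>
    integral_nonneg fun x => mul_self_nonneg (u.1 x)).1 hu
  intro x hx
  simp only [bdry, Set.mem_iUnion] at hx
  obtain ⟨e, he, hx⟩ := hx
  refine eq_zero_of_edgeIntegral_sq he (continuousOn_edge u.2 he) ?_ x hx
  simpa only [edgeIntegral, sq] using h e he

theorem bdry_nonempty (hK : K ∈ G.coarse.cells) : (bdry K).Nonempty := by
  obtain ⟨e, he⟩ := cellEdges_nonempty K (G.coarse.interior_nonempty K hK)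
  obtain ⟨p, q, -, h⟩ := exists_segment_of_mem_cellEdges he
  exact ⟨p, poly_edge_subset_bdry he (h ▸ left_mem_segment ℝ p q)⟩

theorem eq_zero_of_energyForm_eq_zero (hκ : IsCoefficient G κ) (hK : K ∈ G.coarse.cells)
    {u : Vh G K} (hu : energyForm G κ K u u = 0) (hu0 : ∀ x ∈ bdry K, u.1 x = 0) : u = 0 := by
  obtain ⟨y, hy⟩ := bdry_nonempty hK
  refine Subtype.ext (funext fun x => ?_)
  by_cases hx : x ∈ poly K
  · rw [eq_of_energyForm_eq_zero hκ hK hu x hx y (bdry_subset_poly K hy), hu0 y hy]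
    rfl
  · exact u.2.1 x hx

end BoundaryForm

/-! ### Discrete harmonic extensions. -/

section Harmonic

/-- Subtracting from `u` its energy projection onto `Vh0` keeps the trace and gives the
orthogonality. -/
theorem exists_harmonicExt (hκ : IsCoefficient G κ) (hK : K ∈ G.coarse.cells) (u : Vh G K) :
    ∃ v : Vh G K, IsHarmonicExt G κ K u v := by
  have := finiteDimensional_Vh0 hK
  let i := Submodule.inclusion (Vh0_le_Vh G K)
  obtain ⟨w, hw⟩ := exists_riesz ((energyForm G κ K).compl₁₂ i i)
    (fun x hx => Submodule.inclusion_injective (Vh0_le_Vh G K)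
      ((eq_zero_of_energyForm_eq_zero hκ hK hx x.2.2).trans (map_zero i).symm))
    ((energyForm G κ K u).comp i)
  refine ⟨u - i w, (u - i w).2, fun z hz => ?_, fun x hx => ?_⟩
  · have h := hw ⟨z, hz⟩
    have e := energy_eq_energyForm hκ hK (u - i w) (i ⟨z, hz⟩)
    rw [LinearMap.compl₁₂_apply, LinearMap.comp_apply] at h
    rw [map_sub, LinearMap.sub_apply, h, sub_self] at e
    exact e
  · have : w.1 x = 0 := w.2.2 x hx
    change u.1 x - w.1 x = u.1 x
    rw [this, sub_zero]

theorem Vsnap1_le_Vh (G : Grids) (κ : Plane → ℝ) (K : Finset Plane) :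
    Vsnap1 G κ K ≤ Vh G K :=
  Submodule.span_le.2 fun _ ⟨_, _, h⟩ => h.1

theorem finiteDimensional_Vsnap1 (hK : K ∈ G.coarse.cells) :
    FiniteDimensional ℝ (Vsnap1 G κ K) :=
  have := finiteDimensional_Vh hK
  Submodule.finiteDimensional_of_le (Vsnap1_le_Vh G κ K)

theorem energyForm_Vsnap1_Vh0 (hκ : IsCoefficient G κ) (hK : K ∈ G.coarse.cells) {u w : Vh G K}
    (hu : u.1 ∈ Vsnap1 G κ K) (hw : w.1 ∈ Vh0 G K) : energyForm G κ K u w = 0 := by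
  -- The orthogonality defines a subspace of `Vh G K`; it is pushed into the ambient function space,
  -- where the span `Vsnap1` lives.
  let p : Submodule ℝ (Plane → ℝ) :=
    (LinearMap.ker ((energyForm G κ K).flip w)).map (Vh G K).subtype
  have hle : Vsnap1 G κ K ≤ p := by
    refine Submodule.span_le.2 ?_
    rintro v ⟨g, -, hv, ho, -⟩
    refine ⟨⟨v, hv⟩, ?_, rfl⟩
    have := energy_eq_energyForm hκ hK ⟨v, hv⟩ w
    rw [ho _ hw] at this
    exact this.symm
  obtain ⟨u', hu', he⟩ := hle hu
  have : u' = u := Subtype.ext he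
  exact this ▸ hu'

theorem indicator_mem_VhBdry (u : Vh G K) : (bdry K).indicator u.1 ∈ VhBdry G K :=
  ⟨u.1, u.2, rfl⟩

theorem IsHarmonicExt.mem_Vsnap1 {g v : Plane → ℝ} (h : IsHarmonicExt G κ K g v) :
    v ∈ Vsnap1 G κ K :=
  Submodule.subset_span ⟨_, indicator_mem_VhBdry ⟨v, h.1⟩, h.1, h.2.1,
    fun _ hx => (Set.indicator_of_mem hx v).symm⟩

/-- Harmonic extensions already form a subspace: taking the span adds nothing new. -/
theorem isHarmonicExt_of_mem_Vsnap1 (hκ : IsCoefficient G κ) (hK : K ∈ G.coarse.cells)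
    {v g : Plane → ℝ} (hv : v ∈ Vsnap1 G κ K) (hg : ∀ x ∈ bdry K, v x = g x) :
    IsHarmonicExt G κ K g v := by
  refine ⟨Vsnap1_le_Vh G κ K hv, fun w hw => ?_, hg⟩
  rw [energy_eq_energyForm hκ hK ⟨v, Vsnap1_le_Vh G κ K hv⟩ ⟨w, hw.1⟩]
  exact energyForm_Vsnap1_Vh0 hκ hK hv hw

/-- The difference lies in both `Vsnap1` and `Vh0`, hence is energy orthogonal to itself. -/
theorem eq_of_mem_Vsnap1 (hκ : IsCoefficient G κ) (hK : K ∈ G.coarse.cells) {u v : Vh G K}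
    (hu : u.1 ∈ Vsnap1 G κ K) (hv : v.1 ∈ Vsnap1 G κ K) (h : ∀ x ∈ bdry K, u.1 x = v.1 x) :
    u = v := by
  have h0 : ∀ x ∈ bdry K, (u - v).1 x = 0 := fun x hx => sub_eq_zero.2 (h x hx)
  refine sub_eq_zero.1 (eq_zero_of_energyForm_eq_zero hκ hK ?_ h0)
  exact energyForm_Vsnap1_Vh0 hκ hK ((Vsnap1 G κ K).sub_mem hu hv) ⟨(u - v).2, h0⟩

theorem eq_zero_of_mem_Vsnap1 (hκ : IsCoefficient G κ) (hK : K ∈ G.coarse.cells) {u : Vh G K}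
    (hu : u.1 ∈ Vsnap1 G κ K) (h : bdryForm G K u u = 0) : u = 0 :=
  eq_of_mem_Vsnap1 hκ hK hu (Vsnap1 G κ K).zero_mem (eq_zero_of_bdryForm_eq_zero h)

/-- Dirichlet's principle: `v - u` vanishes on the boundary, hence is orthogonal to `u`. -/
theorem energyForm_harmonicExt_le (hκ : IsCoefficient G κ) (hK : K ∈ G.coarse.cells)
    {u v : Vh G K} (hu : u.1 ∈ Vsnap1 G κ K) (h : ∀ x ∈ bdry K, u.1 x = v.1 x) :
    energyForm G κ K u u ≤ energyForm G κ K v v := by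
  have h0 : energyForm G κ K u (v - u) = 0 := energyForm_Vsnap1_Vh0 hκ hK hu
    ⟨(v - u).2, fun x hx => sub_eq_zero.2 (h x hx).symm⟩
  have hn := energyForm_nonneg hκ hK (v - u)
  have hs := energyForm_symm (κ := κ) u v
  simp only [map_sub, LinearMap.sub_apply] at h0 hn
  linarith

end Harmonic

/-! ### The discrete flux and the inverse inequality. -/

section Flux

theorem mem_VhBdry_eqOn {F : Plane → ℝ} (hF : F ∈ VhBdry G K) :
    ∃ w : Vh G K, F = (bdry K).indicator w.1 ∧ ∀ x ∈ bdry K, F x = w.1 x := by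
  obtain ⟨w, hw, rfl⟩ := hF
  exact ⟨⟨w, hw⟩, rfl, fun x hx => Set.indicator_of_mem hx w⟩

/-- On `Vsnap1` a function is determined by its trace, so the boundary form is definite there and
represents `energyForm G κ K u`; the trace of the representative is the flux. -/
theorem exists_isFlux (hκ : IsCoefficient G κ) (hK : K ∈ G.coarse.cells) (u : Vh G K) :
    ∃ F, IsFlux G κ K u F := by
  have := finiteDimensional_Vsnap1 (κ := κ) hK
  let i := Submodule.inclusion (Vsnap1_le_Vh G κ K)
  obtain ⟨w, hw⟩ := exists_riesz ((bdryForm G K).compl₁₂ i i)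
    (fun x hx => Submodule.inclusion_injective (Vsnap1_le_Vh G κ K)
      ((eq_zero_of_mem_Vsnap1 hκ hK x.2 hx).trans (map_zero i).symm))
    ((energyForm G κ K u).comp i)
  refine ⟨_, indicator_mem_VhBdry (i w), fun g _ v hv => ?_⟩
  have h := hw ⟨v, hv.mem_Vsnap1⟩
  rw [LinearMap.compl₁₂_apply, LinearMap.comp_apply, bdryForm_apply] at h
  refine Eq.trans ?_ (h.trans (energy_eq_energyForm hκ hK u _).symm)
  exact bdryIntegral_congr fun x hx => by
    rw [Set.indicator_of_mem hx, ← hv.2.2 x hx]; rfl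

theorem isFlux_flux (hκ : IsCoefficient G κ) (hK : K ∈ G.coarse.cells) (u : Vh G K) :
    IsFlux G κ K u (flux G κ K u) :=
  Classical.epsilon_spec (exists_isFlux hκ hK u)

theorem IsFlux.bdryIntegral_eq (hκ : IsCoefficient G κ) (hK : K ∈ G.coarse.cells) {u v : Vh G K}
    {F : Plane → ℝ} (hF : IsFlux G κ K u F) (hv : v.1 ∈ Vsnap1 G κ K) :
    bdryIntegral K (fun x => F x * v.1 x) = energyForm G κ K u v := by
  rw [← energy_eq_energyForm hκ hK, ← hF.2 _ (indicator_mem_VhBdry v) v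
    (isHarmonicExt_of_mem_Vsnap1 hκ hK hv fun x hx => (Set.indicator_of_mem hx _).symm)]
  exact bdryIntegral_congr fun x hx => by rw [Set.indicator_of_mem hx]

/-- The flux has a harmonic representative. -/
theorem IsFlux.exists_rep (hκ : IsCoefficient G κ) (hK : K ∈ G.coarse.cells) {u : Vh G K}
    {F : Plane → ℝ} (hF : IsFlux G κ K u F) :
    ∃ w : Vh G K, w.1 ∈ Vsnap1 G κ K ∧ F = (bdry K).indicator w.1 ∧
      ∀ v : Vh G K, v.1 ∈ Vsnap1 G κ K → bdryForm G K w v = energyForm G κ K u v := by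
  obtain ⟨w', hw', hw''⟩ := mem_VhBdry_eqOn hF.1
  obtain ⟨w, hw⟩ := exists_harmonicExt hκ hK w'
  have hFw : F = (bdry K).indicator w.1 := by
    rw [hw']
    exact Set.indicator_congr fun x hx => (hw.2.2 x hx).symm
  refine ⟨w, hw.mem_Vsnap1, hFw, fun v hv => ?_⟩
  rw [← hF.bdryIntegral_eq hκ hK hv, bdryForm_apply]
  exact bdryIntegral_congr fun x hx => by rw [hFw, Set.indicator_of_mem hx]

/-- Uniqueness makes the choice inside `flux` canonical; its additivity rests on this. -/
theorem IsFlux.unique (hκ : IsCoefficient G κ) (hK : K ∈ G.coarse.cells) {u : Vh G K}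
    {F F' : Plane → ℝ} (hF : IsFlux G κ K u F) (hF' : IsFlux G κ K u F') : F = F' := by
  obtain ⟨w, hw, rfl, h⟩ := hF.exists_rep hκ hK
  obtain ⟨w', hw', rfl, h'⟩ := hF'.exists_rep hκ hK
  have hd : (w - w').1 ∈ Vsnap1 G κ K := (Vsnap1 G κ K).sub_mem hw hw'
  have : w - w' = 0 := eq_zero_of_mem_Vsnap1 hκ hK hd (by
    rw [map_sub (bdryForm G K) w, LinearMap.sub_apply, h _ hd, h' _ hd, sub_self])
  rw [sub_eq_zero.1 this]

theorem flux_eq_of_form_eq (hκ : IsCoefficient G κ) (hK : K ∈ G.coarse.cells) (u w : Vh G K)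
    (h : ∀ v : Vh G K, v.1 ∈ Vsnap1 G κ K → bdryForm G K w v = energyForm G κ K u v) :
    flux G κ K u = (bdry K).indicator w.1 := by
  refine (isFlux_flux hκ hK u).unique hκ hK ⟨indicator_mem_VhBdry w, fun g _ v hv => ?_⟩
  rw [energy_eq_energyForm hκ hK u ⟨v, hv.1⟩, ← h ⟨v, hv.1⟩ hv.mem_Vsnap1, bdryForm_apply]
  exact bdryIntegral_congr fun x hx => by rw [Set.indicator_of_mem hx, ← hv.2.2 x hx]

theorem flux_add (hκ : IsCoefficient G κ) (hK : K ∈ G.coarse.cells) {u v : Plane → ℝ}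
    (hu : u ∈ Vh G K) (hv : v ∈ Vh G K) :
    flux G κ K (u + v) = flux G κ K u + flux G κ K v := by
  obtain ⟨w, -, hw, h⟩ := (isFlux_flux hκ hK ⟨u, hu⟩).exists_rep hκ hK
  obtain ⟨w', -, hw', h'⟩ := (isFlux_flux hκ hK ⟨v, hv⟩).exists_rep hκ hK
  refine (flux_eq_of_form_eq hκ hK (⟨u, hu⟩ + ⟨v, hv⟩) (w + w') fun z hz => by
    rw [map_add, map_add, LinearMap.add_apply, LinearMap.add_apply, h z hz, h' z hz]).trans ?_
  exact (Set.indicator_add' _ _ _).trans (congrArg₂ (· + ·) hw.symm hw'.symm)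

/-- The flux only tests `u` against harmonic functions, and these are orthogonal to `Vh0`. -/
theorem flux_eq_zero (hκ : IsCoefficient G κ) (hK : K ∈ G.coarse.cells) {u : Plane → ℝ}
    (hu : u ∈ Vh0 G K) : flux G κ K u = 0 := by
  rw [flux_eq_of_form_eq hκ hK ⟨u, hu.1⟩ 0 fun z hz => by
    rw [map_zero, LinearMap.zero_apply, energyForm_symm,
      energyForm_Vsnap1_Vh0 hκ hK hz hu]]
  exact Set.indicator_zero' _

theorem bdryIntegral_flux_sq (hκ : IsCoefficient G κ) (hK : K ∈ G.coarse.cells) (u : Vh G K) :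
    ∃ w : Vh G K, w.1 ∈ Vsnap1 G κ K ∧
      bdryIntegral K (fun x => flux G κ K u x ^ 2) = bdryForm G K w w ∧
      ∀ v : Vh G K, v.1 ∈ Vsnap1 G κ K → bdryForm G K w v = energyForm G κ K u v := by
  obtain ⟨w, hw, hF, h⟩ := (isFlux_flux hκ hK u).exists_rep hκ hK
  refine ⟨w, hw, ?_, h⟩
  rw [hF, bdryForm_apply]
  exact bdryIntegral_congr fun x hx => by rw [Set.indicator_of_mem hx, sq]

/-- Young's inequality: expand `B (t x - y) (t x - y) ≥ 0` and divide by `t`. -/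
theorem two_mul_form_le {E : Type*} [AddCommGroup E] [Module ℝ E] (B : E →ₗ[ℝ] E →ₗ[ℝ] ℝ)
    (hsymm : ∀ x y, B x y = B y x) (hnonneg : ∀ x, 0 ≤ B x x) {t : ℝ} (ht : 0 < t) (x y : E) :
    2 * B x y ≤ t * B x x + t⁻¹ * B y y := by
  have h := hnonneg (t • x - y)
  simp only [map_sub, map_smul, LinearMap.sub_apply, LinearMap.smul_apply, smul_eq_mul,
    hsymm y x] at h
  have h2 := mul_nonneg (inv_pos.2 ht).le h
  have e : t⁻¹ * (t * (t * B x x) - t * B x y - (t * B x y - B y y))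
      = t * B x x + t⁻¹ * B y y - 2 * B x y := by
    field_simp
    ring
  rw [show t⁻¹ * (t * (t * B x x - B x y) - (t * B x y - B y y))
      = t⁻¹ * (t * (t * B x x) - t * B x y - (t * B x y - B y y)) by ring, e] at h2
  linarith

/-- The dual of the inverse inequality. The harmonic representative `w` of the flux satisfies `‖w‖²
= a(u, w)` on the boundary; by Young with parameter `s`, half of `‖w‖²` absorbs the term `a(w, w) /
(2 s)`. -/
theorem bdryIntegral_flux_sq_le (hκ : IsCoefficient G κ) (hK : K ∈ G.coarse.cells) {c : ℝ}
    (hc : IsInverseConstant G κ c) (u : Vh G K) :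
    bdryIntegral K (fun x => flux G κ K u x ^ 2) ≤
      cellMax κ K * c ^ 2 * (G.fine.size)⁻¹ * energyForm G κ K u u := by
  obtain ⟨w, hw, hF, h⟩ := bdryIntegral_flux_sq hκ hK u
  rw [hF]
  set s := cellMax κ K * c ^ 2 * (G.fine.size)⁻¹ with hs
  have hspos : 0 < s := by
    have := hκ.one_le_cellMax hK
    have := fine_size_pos hK
    have := hc.1
    positivity
  have h1 := two_mul_form_le (energyForm G κ K) energyForm_symm (energyForm_nonneg hκ hK)
    hspos u w
  have h2 := hc.2 K hK _ (indicator_mem_VhBdry w) w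
    (isHarmonicExt_of_mem_Vsnap1 hκ hK hw fun x hx => (Set.indicator_of_mem hx _).symm)
  have h3 : bdryIntegral K (fun x => (bdry K).indicator w.1 x ^ 2) = bdryForm G K w w :=
    bdryIntegral_congr fun x hx => by rw [Set.indicator_of_mem hx, sq]
  rw [h3, ← hs, energy_eq_energyForm hκ hK] at h2
  rw [← h w hw] at h1
  have h4 : s⁻¹ * energyForm G κ K w w ≤ bdryForm G K w w := by
    rw [inv_mul_le_iff₀ hspos]; exact h2
  linarith

/-- Dependence on `κ` is removed by comparing with the harmonic extension `v'` for `κ = 1`: it has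
the same trace, at least as much `κ`-energy, and its `κ`-energy is at most `κ_K` times its
unweighted energy. -/
theorem exists_inverseConstant (G : Grids) : ∃ c : ℝ, ∀ κ : Plane → ℝ, IsCoefficient G κ →
    IsInverseConstant G κ c := by
  have hex : ∀ K : Finset Plane, ∃ c : ℝ, 0 ≤ c ∧ (K ∈ G.coarse.cells → ∀ v : Vh G K,
      v.1 ∈ Vsnap1 G (fun _ => 1) K →
      energyForm G (fun _ => 1) K v v ≤ c * bdryForm G K v v) := by
    intro K
    by_cases hK : K ∈ G.coarse.cells
    · have := finiteDimensional_Vsnap1 (κ := fun _ => 1) hK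
      let i := Submodule.inclusion (Vsnap1_le_Vh G (fun _ => 1) K)
      obtain ⟨c, hc, h⟩ := exists_form_le_of_definite ((bdryForm G K).compl₁₂ i i)
        ((energyForm G (fun _ => 1) K).compl₁₂ i i) (fun x y => bdryForm_symm _ _)
        (fun x => bdryForm_nonneg _)
        (fun x hx => Submodule.inclusion_injective (Vsnap1_le_Vh G _ K)
          ((eq_zero_of_mem_Vsnap1 (isCoefficient_one G) hK x.2 hx).trans (map_zero i).symm))
      exact ⟨c, hc, fun _ v hv => h ⟨v.1, hv⟩⟩
    · exact ⟨0, le_rfl, fun h => absurd h hK⟩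
  choose c hc0 hc using hex
  -- Summing over the cells gives one constant for all of them; in `√C + 1` the added 1 ensures
  -- strict positivity.
  set C := ∑ K ∈ G.coarse.cells, c K * G.fine.size with hC
  refine ⟨√C + 1, fun κ hκ => ⟨by positivity, fun K hK g hg v hv => ?_⟩⟩
  have hh := fine_size_pos hK
  have hCc : c K * G.fine.size ≤ C :=
    Finset.single_le_sum (f := fun K => c K * G.fine.size)
      (fun L _ => mul_nonneg (hc0 L) hh.le) hK
  have hC0 : 0 ≤ C := (mul_nonneg (hc0 K) hh.le).trans hCc
  have hCsq : c K ≤ (√C + 1) ^ 2 * (G.fine.size)⁻¹ := by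
    rw [← div_eq_mul_inv, le_div_iff₀ hh]
    nlinarith [Real.sq_sqrt hC0, Real.sqrt_nonneg C]
  obtain ⟨v', hv'⟩ := exists_harmonicExt (isCoefficient_one G) hK ⟨v, hv.1⟩
  have h1 := energyForm_harmonicExt_le hκ hK (u := ⟨v, hv.1⟩) (v := v') hv.mem_Vsnap1
    fun x hx => (hv'.2.2 x hx).symm
  have h2 := energyForm_le_one hκ hK v'
  have h3 := hc K hK v' hv'.mem_Vsnap1
  have h4 : bdryForm G K v' v' = bdryIntegral K (fun x => g x ^ 2) :=
    bdryIntegral_congr fun x hx => by rw [hv'.2.2 x hx, sq, ← hv.2.2 x hx]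
  have h5 := hκ.one_le_cellMax hK
  rw [energy_eq_energyForm hκ hK ⟨v, hv.1⟩ ⟨v, hv.1⟩, ← h4]
  calc energyForm G κ K ⟨v, hv.1⟩ ⟨v, hv.1⟩
      ≤ cellMax κ K * (c K * bdryForm G K v' v') :=
        h1.trans (h2.trans (mul_le_mul_of_nonneg_left h3 (by linarith)))
    _ ≤ cellMax κ K * ((√C + 1) ^ 2 * (G.fine.size)⁻¹ * bdryForm G K v' v') :=
        mul_le_mul_of_nonneg_left (mul_le_mul_of_nonneg_right hCsq (bdryForm_nonneg _))
          (by linarith)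
    _ = _ := by ring

end Flux

/-! ### Positivity and comparison of the weights `κ̄` and `κ̃`. -/

section Weights

theorem mem_edges {e : Finset Plane} (hK : K ∈ G.coarse.cells) (he : e ∈ cellEdges K) :
    e ∈ G.coarse.edges := by
  classical
  exact Finset.mem_biUnion.2 ⟨K, hK, he⟩

theorem one_le_edgeKappa (hκ : IsCoefficient G κ) {e : Finset Plane} (he : e ∈ G.coarse.edges) :
    1 ≤ edgeKappa G κ e := by
  have hp := hκ.one_le_cellMax (G.plus_mem e he).1
  rw [edgeKappa]
  split_ifs with hi
  · have hm := hκ.one_le_cellMax (G.minus_mem e he hi).1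
    linarith
  · exact hp

theorem edgeKappa_le_cellKappa {e : Finset Plane} (he : e ∈ cellEdges K) :
    edgeKappa G κ e ≤ cellKappa G κ K :=
  le_csSup ((cellEdges K).finite_toSet.image _).bddAbove ⟨e, he, rfl⟩

theorem cellKappa_pos (hκ : IsCoefficient G κ) (hK : K ∈ G.coarse.cells) :
    0 < cellKappa G κ K := by
  obtain ⟨e, he⟩ := cellEdges_nonempty K (G.coarse.interior_nonempty K hK)
  have h1 := one_le_edgeKappa hκ (mem_edges hK he)
  have h2 := edgeKappa_le_cellKappa (G := G) (κ := κ) he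
  linarith

end Weights

/-! ### The weighted mass form of the interior spectral problem. -/

section MassForm

theorem integrableOn_poly {g : Plane → ℝ} (hg : ContinuousOn g (poly K)) :
    IntegrableOn g (poly K) :=
  hg.integrableOn_compact (isCompact_poly K)

theorem integrableOn_kappa_mul (hκ : IsCoefficient G κ) (hK : K ∈ G.coarse.cells)
    (u v : Vh G K) : IntegrableOn (fun x => κ x * (u.1 x * v.1 x)) (poly K) :=
  hκ.integrableOn_mul hK (integrableOn_poly (u.2.2.1.mul v.2.2.1))

/-- The weighted `L²` form on the fine space as a bilinear map. -/
def massForm (hκ : IsCoefficient G κ) (hK : K ∈ G.coarse.cells) :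
    Vh G K →ₗ[ℝ] Vh G K →ₗ[ℝ] ℝ :=
  LinearMap.mk₂ ℝ (fun u v => ∫ x in poly K, κ x * (u.1 x * v.1 x))
    (fun u u' v => by
      rw [← integral_add (integrableOn_kappa_mul hκ hK u v) (integrableOn_kappa_mul hκ hK u' v)]
      simp [add_mul, mul_add])
    (fun c u v => by
      simp [← integral_const_mul, mul_assoc, mul_left_comm])
    (fun u v v' => by
      rw [← integral_add (integrableOn_kappa_mul hκ hK u v) (integrableOn_kappa_mul hκ hK u v')]
      simp [mul_add])
    (fun c u v => by
      simp [← integral_const_mul, mul_left_comm])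

theorem massForm_apply (hκ : IsCoefficient G κ) (hK : K ∈ G.coarse.cells) (u v : Vh G K) :
    massForm hκ hK u v = ∫ x in poly K, κ x * (u.1 x * v.1 x) := rfl

theorem massForm_symm (hκ : IsCoefficient G κ) (hK : K ∈ G.coarse.cells) (u v : Vh G K) :
    massForm hκ hK u v = massForm hκ hK v u := by
  simp only [massForm_apply, mul_comm (u.1 _)]

theorem integral_sq_le_massForm (hκ : IsCoefficient G κ) (hK : K ∈ G.coarse.cells) (u : Vh G K) :
    ∫ x in poly K, u.1 x ^ 2 ≤ massForm hκ hK u u := by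
  rw [massForm_apply]
  refine setIntegral_mono_ae_restrict (integrableOn_poly (u.2.2.1.pow 2))
    (integrableOn_kappa_mul hκ hK u u) ?_
  filter_upwards [hκ.one_le_poly hK] with x hx
  nlinarith [mul_self_nonneg (u.1 x)]

/-- A continuous function vanishing almost everywhere on the cell vanishes on the closure of its
interior, which is the whole cell. -/
theorem massForm_pos (hκ : IsCoefficient G κ) (hK : K ∈ G.coarse.cells) {u : Vh G K}
    (hu : u ≠ 0) : 0 < massForm hκ hK u u := by
  refine lt_of_lt_of_le ?_ (integral_sq_le_massForm hκ hK u)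
  refine lt_of_le_of_ne (integral_nonneg fun x => sq_nonneg _) fun h => hu ?_
  have hae := (integral_eq_zero_iff_of_nonneg (fun x => sq_nonneg (u.1 x))
    (integrableOn_poly (u.2.2.1.pow 2))).1 h.symm
  have hsub : poly K ⊆ closure (interior (poly K)) := by
    rw [(convex_convexHull ℝ (K : Set Plane)).closure_interior_eq_closure_of_nonempty_interior
      (G.coarse.interior_nonempty K hK)]
    exact subset_closure
  have heq := Measure.eqOn_of_ae_eq hae (u.2.2.1.pow 2) continuousOn_const hsub
  refine Subtype.ext (funext fun x => ?_)
  by_cases hx : x ∈ poly K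
  · exact pow_eq_zero_iff (two_ne_zero) |>.1 (heq hx)
  · exact u.2.1 x hx

end MassForm

/-! ### Spectral approximation in the two snapshot spaces. -/

section Spectral

theorem invNext_nonneg {lam : ℕ → ℝ} {M l : ℕ} (h : l < M → 0 < lam (l + 1)) :
    0 ≤ invNext lam M l := by
  rw [invNext]
  split_ifs with hl
  · exact one_div_nonneg.2 (h hl).le
  · exact le_rfl

/-- The projection onto the span of the first eigenvectors, together with the gap estimate. -/
theorem IsEigenSystem.exists_projection {V : Submodule ℝ (Plane → ℝ)} [FiniteDimensional ℝ V]
    {af mf : (Plane → ℝ) → (Plane → ℝ) → ℝ} {φ : ℕ → Plane → ℝ} {lam : ℕ → ℝ}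
    (h : IsEigenSystem V af mf φ lam) (a m : V →ₗ[ℝ] V →ₗ[ℝ] ℝ)
    (haf : ∀ u v : V, af u v = a u v) (hmf : ∀ u v : V, mf u v = m u v)
    (ha : ∀ x y, a x y = a y x) (hm : ∀ x y, m x y = m y x) (hpos : ∀ x, x ≠ 0 → 0 < m x x)
    {l : ℕ} (hl : l ≤ Module.finrank ℝ V)
    (hlam : l < Module.finrank ℝ V → 0 < lam (l + 1)) (u : V) :
    ∃ v : V, (v : Plane → ℝ) ∈ Submodule.span ℝ (φ '' Set.Icc 1 l) ∧ a v (u - v) = 0 ∧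
      m (u - v) (u - v) ≤ invNext lam (Module.finrank ℝ V) l * a (u - v) (u - v) ∧
      (invNext lam (Module.finrank ℝ V) l = 0 → u - v = 0) := by
  classical
  -- Membership in `V` is known only for indices up to the dimension; `l ≤ finrank` keeps the
  -- default value 0 out of the span.
  let ψ : ℕ → V := fun k =>
    if hk : k ∈ Set.Icc 1 (Module.finrank ℝ V) then ⟨φ k, h.mem k hk⟩ else 0
  have hψ : ∀ k ∈ Set.Icc 1 (Module.finrank ℝ V), (ψ k : Plane → ℝ) = φ k := fun k hk => by
    simp only [ψ, dif_pos hk]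
  obtain ⟨v, hv, h0, hz, hg⟩ := exists_eigen_projection a m ha hm hpos ψ lam
    (fun k hk h' => h.ne_zero k hk (by rw [← hψ k hk, h']; rfl))
    (fun k hk v => by rw [← haf, ← hmf, hψ k hk]; exact h.eigen k hk v v.2)
    h.strictMono l u
  refine ⟨v, ?_, h0, ?_, ?_⟩
  · have := Submodule.mem_map_of_mem (f := V.subtype) hv
    rw [Submodule.map_span, Set.image_image] at this
    have himg : (fun k => V.subtype (ψ k)) '' Set.Icc 1 l = φ '' Set.Icc 1 l :=
      Set.image_congr fun k hk => hψ k ⟨hk.1, hk.2.trans hl⟩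
    rwa [himg] at this
  · rw [invNext]
    split_ifs with hlt
    · rw [one_div, ← div_eq_inv_mul, le_div_iff₀ (hlam hlt), mul_comm]
      exact hg hlt
    · rw [hz (le_antisymm hl (not_lt.1 hlt))]
      simp
  -- The next eigenvalue being positive, `invNext` vanishes only when every eigenvector is used, and
  -- then nothing is left over.
  · intro hi
    rw [invNext] at hi
    split_ifs at hi with hlt
    · exact absurd hi (one_div_pos.2 (hlam hlt)).ne'
    · exact hz (le_antisymm hl (not_lt.1 hlt))

theorem IsEigenSystem.lam_mul_pos {V : Submodule ℝ (Plane → ℝ)}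
    {af mf : (Plane → ℝ) → (Plane → ℝ) → ℝ} {φ : ℕ → Plane → ℝ} {lam : ℕ → ℝ}
    (h : IsEigenSystem V af mf φ lam) (hpos : ∀ x ∈ V, x ≠ 0 → 0 < mf x x) {k : ℕ}
    (hk : k ∈ Set.Icc 1 (Module.finrank ℝ V)) :
    0 < mf (φ k) (φ k) ∧ af (φ k) (φ k) = lam k * mf (φ k) (φ k) :=
  ⟨hpos _ (h.mem k hk) (h.ne_zero k hk), h.eigen k hk _ (h.mem k hk)⟩

/-- For the residual `w = u - v`, orthogonality gives `a(w, w) = a(u, w) = ∫ flux(u) w`; the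
spectral gap bounds the boundary norm of `w` by its energy, which is then absorbed. -/
theorem exists_harmonic_approx (hκ : IsCoefficient G κ) (hK : K ∈ G.coarse.cells)
    {φ : ℕ → Plane → ℝ} {lam : ℕ → ℝ}
    (h : IsEigenSystem (Vsnap1 G κ K) (energy κ K) (mass1 G κ K) φ lam) {l : ℕ} (hl1 : 1 ≤ l)
    (hl : l ≤ Module.finrank ℝ (Vsnap1 G κ K)) (u : Vh G K) (hu : u.1 ∈ Vsnap1 G κ K) :
    ∃ v : Vh G K, v.1 ∈ Submodule.span ℝ (φ '' Set.Icc 1 l) ∧ v.1 ∈ Vsnap1 G κ K ∧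
      energyForm G κ K (u - v) (u - v) ≤
        (G.coarse.size / cellKappa G κ K *
          invNext lam (Module.finrank ℝ (Vsnap1 G κ K)) l) *
        bdryIntegral K (fun x => flux G κ K u x ^ 2) ∧
      cellKappa G κ K * bdryForm G K (u - v) (u - v) ≤
        G.coarse.size * invNext lam (Module.finrank ℝ (Vsnap1 G κ K)) l *
          energyForm G κ K (u - v) (u - v) ∧
      0 ≤ invNext lam (Module.finrank ℝ (Vsnap1 G κ K)) l := by
  have := finiteDimensional_Vsnap1 (κ := κ) hK
  let i := Submodule.inclusion (Vsnap1_le_Vh G κ K)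
  have hi : Function.Injective i := Submodule.inclusion_injective _
  have hH := coarse_size_pos hK
  have hk := cellKappa_pos hκ hK
  let a := (energyForm G κ K).compl₁₂ i i
  let m := ((G.coarse.size)⁻¹ * cellKappa G κ K) • (bdryForm G K).compl₁₂ i i
  have haf : ∀ u v : Vsnap1 G κ K, energy κ K u v = a u v := fun u v =>
    energy_eq_energyForm hκ hK (i u) (i v)
  have hmf : ∀ u v : Vsnap1 G κ K, mass1 G κ K u v = m u v := by
    intro u v
    change _ = (G.coarse.size)⁻¹ * cellKappa G κ K * bdryForm G K (i u) (i v)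
    rw [bdryForm_apply, mul_assoc, mass1]
    simp only [bdryIntegral, edgeIntegral, integral_const_mul, Finset.mul_sum]
    rfl
  have hmpos : ∀ x, x ≠ 0 → 0 < m x x := by
    intro x hx
    refine mul_pos (by positivity) (lt_of_le_of_ne (bdryForm_nonneg _) fun h0 => hx (hi ?_))
    rw [map_zero]
    exact eq_zero_of_mem_Vsnap1 hκ hK x.2 h0.symm
  have hpos : ∀ x ∈ Vsnap1 G κ K, x ≠ 0 → 0 < mass1 G κ K x x := fun x hx hx0 => by
    rw [hmf ⟨x, hx⟩ ⟨x, hx⟩]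
    exact hmpos _ fun h => hx0 (congrArg Subtype.val h)
  -- Only `0 ≤ lam 1` is available, since constants carry no energy; `1 ≤ l` and strict growth make
  -- the next eigenvalue positive.
  have hlam : l < Module.finrank ℝ (Vsnap1 G κ K) → 0 < lam (l + 1) := by
    intro hlt
    have h1 : 1 ∈ Set.Icc 1 (Module.finrank ℝ (Vsnap1 G κ K)) := ⟨le_rfl, by omega⟩
    obtain ⟨hp, he⟩ := h.lam_mul_pos hpos h1
    have hn : 0 ≤ energy κ K (φ 1) (φ 1) := by
      rw [haf ⟨φ 1, h.mem 1 h1⟩ ⟨φ 1, h.mem 1 h1⟩]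
      exact energyForm_nonneg hκ hK _
    rw [he] at hn
    exact (nonneg_of_mul_nonneg_left hn hp).trans_lt
      (h.strictMono h1 ⟨by omega, hlt⟩ (by omega))
  obtain ⟨v, hv, h0, hg, hz⟩ := h.exists_projection a m haf hmf (fun _ _ => energyForm_symm _ _)
    (fun x y => congrArg _ (bdryForm_symm (i x) (i y))) hmpos hl hlam ⟨u.1, hu⟩
  have hinv := invNext_nonneg hlam
  set p := invNext lam (Module.finrank ℝ (Vsnap1 G κ K)) l with hp
  have hvm : (u - i v).1 ∈ Vsnap1 G κ K := (Vsnap1 G κ K).sub_mem hu v.2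
  change energyForm G κ K (i v) (u - i v) = 0 at h0
  change (G.coarse.size)⁻¹ * cellKappa G κ K * bdryForm G K (u - i v) (u - i v)
    ≤ p * energyForm G κ K (u - i v) (u - i v) at hg
  have hB : cellKappa G κ K * bdryForm G K (u - i v) (u - i v) ≤
      G.coarse.size * p * energyForm G κ K (u - i v) (u - i v) := by
    rw [mul_assoc, ← inv_mul_le_iff₀ hH, ← mul_assoc]
    exact hg
  refine ⟨i v, hv, v.2, ?_, hB, hinv⟩
  obtain ⟨w, hw, hF, hrep⟩ := bdryIntegral_flux_sq hκ hK u
  -- The Young parameter `s` is proportional to `p`, so the case `p = 0` is separate; there the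
  -- residual is zero.
  rcases hinv.eq_or_lt with hp0 | hppos
  · have hz' : u - i v = 0 := congrArg i (hz hp0.symm) |>.trans (map_zero i)
    rw [hz', ← hp0]
    simp
  · set s := G.coarse.size / cellKappa G κ K * p with hs
    have hspos : 0 < s := by positivity
    have h1 := two_mul_form_le (bdryForm G K) bdryForm_symm bdryForm_nonneg hspos w (u - i v)
    have h2 : energyForm G κ K (u - i v) (u - i v) = energyForm G κ K u (u - i v) := by
      have : energyForm G κ K (u - i v) (u - i v)
          = energyForm G κ K u (u - i v) - energyForm G κ K (i v) (u - i v) := by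
        rw [← LinearMap.sub_apply, ← map_sub]
      rw [this, h0, sub_zero]
    have h3 : s⁻¹ * bdryForm G K (u - i v) (u - i v)
        ≤ energyForm G κ K (u - i v) (u - i v) := by
      rw [inv_mul_le_iff₀ hspos, hs]
      have : bdryForm G K (u - i v) (u - i v) ≤
          (G.coarse.size * p * energyForm G κ K (u - i v) (u - i v)) / cellKappa G κ K := by
        rw [le_div_iff₀ hk, mul_comm]; exact hB
      refine this.trans (le_of_eq ?_)
      ring
    rw [hrep _ hvm, ← h2] at h1
    rw [hF]
    linarith

/-- Here `a(w, w) = a(u, w) = ∫ f w` for the residual `w`, and the gap bounds `∫ κ w²` by its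
energy. -/
theorem exists_interior_approx (hκ : IsCoefficient G κ) (hK : K ∈ G.coarse.cells)
    {ξ : ℕ → Plane → ℝ} {lam : ℕ → ℝ}
    (h : IsEigenSystem (Vh0 G K) (energy κ K) (mass2 G κ K) ξ lam) {l : ℕ}
    (hl : l ≤ Module.finrank ℝ (Vh0 G K)) (u : Vh G K) (hu : u.1 ∈ Vh0 G K) {f : Plane → ℝ}
    (hf : MemLp f 2 (volume.restrict (poly K)))
    (huf : ∀ w : Vh G K, w.1 ∈ Vh0 G K → energyForm G κ K u w = ∫ x in poly K, f x * w.1 x) :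
    ∃ v : Vh G K, v.1 ∈ Submodule.span ℝ (ξ '' Set.Icc 1 l) ∧ v.1 ∈ Vh0 G K ∧
      energyForm G κ K (u - v) (u - v) ≤
        G.coarse.size ^ 2 * invNext lam (Module.finrank ℝ (Vh0 G K)) l *
          ∫ x in poly K, f x ^ 2 := by
  have := finiteDimensional_Vh0 hK
  let i := Submodule.inclusion (Vh0_le_Vh G K)
  have hi : Function.Injective i := Submodule.inclusion_injective _
  have hH := coarse_size_pos hK
  let a := (energyForm G κ K).compl₁₂ i i
  let m := ((G.coarse.size ^ 2)⁻¹) • (massForm hκ hK).compl₁₂ i i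
  have haf : ∀ u v : Vh0 G K, energy κ K u v = a u v := fun u v =>
    energy_eq_energyForm hκ hK (i u) (i v)
  have hmf : ∀ u v : Vh0 G K, mass2 G κ K u v = m u v := fun u v => rfl
  have hmpos : ∀ x, x ≠ 0 → 0 < m x x := fun x hx =>
    mul_pos (by positivity) (massForm_pos hκ hK fun h => hx (hi (h.trans (map_zero i).symm)))
  have hpos : ∀ x ∈ Vh0 G K, x ≠ 0 → 0 < mass2 G κ K x x := fun x hx hx0 => by
    rw [hmf ⟨x, hx⟩ ⟨x, hx⟩]
    exact hmpos _ fun h => hx0 (congrArg Subtype.val h)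
  -- The energy is definite on `Vh0`, so every eigenvalue is positive and `l = 0` is allowed.
  have hlam : l < Module.finrank ℝ (Vh0 G K) → 0 < lam (l + 1) := by
    intro hlt
    have h1 : l + 1 ∈ Set.Icc 1 (Module.finrank ℝ (Vh0 G K)) := ⟨by omega, by omega⟩
    obtain ⟨hp, he⟩ := h.lam_mul_pos hpos h1
    have hn : 0 < energy κ K (ξ (l + 1)) (ξ (l + 1)) := by
      let x : Vh0 G K := ⟨ξ (l + 1), h.mem _ h1⟩
      rw [haf x x]
      refine lt_of_le_of_ne (energyForm_nonneg hκ hK (i x)) fun h0 => h.ne_zero _ h1 ?_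
      exact congrArg Subtype.val (eq_zero_of_energyForm_eq_zero hκ hK h0.symm x.2.2)
    rw [he] at hn
    exact pos_of_mul_pos_left hn hp.le
  obtain ⟨v, hv, h0, hg, hz⟩ := h.exists_projection a m haf hmf (fun _ _ => energyForm_symm _ _)
    (fun x y => congrArg _ (massForm_symm hκ hK (i x) (i y))) hmpos hl hlam ⟨u.1, hu⟩
  have hinv := invNext_nonneg hlam
  set p := invNext lam (Module.finrank ℝ (Vh0 G K)) l with hp
  have hvm : (u - i v).1 ∈ Vh0 G K := (Vh0 G K).sub_mem hu v.2
  change energyForm G κ K (i v) (u - i v) = 0 at h0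
  change (G.coarse.size ^ 2)⁻¹ * massForm hκ hK (u - i v) (u - i v)
    ≤ p * energyForm G κ K (u - i v) (u - i v) at hg
  refine ⟨i v, hv, v.2, ?_⟩
  rcases hinv.eq_or_lt with hp0 | hppos
  · have hz' : u - i v = 0 := congrArg i (hz hp0.symm) |>.trans (map_zero i)
    rw [hz', ← hp0]
    simp
  · set s := G.coarse.size ^ 2 * p with hs
    have hspos : 0 < s := by positivity
    set w := u - i v with hw
    have h2 : energyForm G κ K w w = energyForm G κ K u w := by
      have : energyForm G κ K w w = energyForm G κ K u w - energyForm G κ K (i v) w := by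
        rw [← LinearMap.sub_apply, ← map_sub]
      rw [this, h0, sub_zero]
    have hwint : IntegrableOn (fun x => w.1 x ^ 2) (poly K) := integrableOn_poly (w.2.2.1.pow 2)
    have hwL : MemLp w.1 2 (volume.restrict (poly K)) := by
      rw [memLp_two_iff_integrable_sq (w.2.2.1.aestronglyMeasurable (measurableSet_poly K))]
      exact hwint
    have h1 : 2 * ∫ x in poly K, f x * w.1 x ≤
        s * (∫ x in poly K, f x ^ 2) + s⁻¹ * ∫ x in poly K, w.1 x ^ 2 := by
      rw [← integral_const_mul, ← integral_const_mul, ← integral_const_mul,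
        ← integral_add (hf.integrable_sq.const_mul _) (hwint.const_mul _)]
      refine integral_mono ((hf.integrable_mul hwL).const_mul _)
        ((hf.integrable_sq.const_mul _).add (hwint.const_mul _)) fun x => ?_
      have h3 := mul_nonneg (inv_pos.2 hspos).le (sq_nonneg (s * f x - w.1 x))
      have h4 : s⁻¹ * (s * f x - w.1 x) ^ 2
          = s * f x ^ 2 + s⁻¹ * w.1 x ^ 2 - 2 * (f x * w.1 x) := by
        field_simp
        ring
      beta_reduce
      linarith
    -- The load carries no weight, so `κ ≥ 1` is used to pass from `∫ w²` to the weighted mass.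
    have h3 : s⁻¹ * ∫ x in poly K, w.1 x ^ 2 ≤ energyForm G κ K w w := by
      rw [inv_mul_le_iff₀ hspos, hs, mul_assoc, ← inv_mul_le_iff₀ (by positivity)]
      exact (mul_le_mul_of_nonneg_left (integral_sq_le_massForm hκ hK w)
        (by positivity)).trans hg
    rw [← huf w hvm, ← h2] at h1
    linarith

end Spectral

/-! ### Jumps, averaged fluxes, and passing from edge sums to cell sums. -/

section EdgeTraces

theorem continuousOn_flux (hκ : IsCoefficient G κ) (hK : K ∈ G.coarse.cells) {u : Plane → ℝ}
    (hu : u ∈ Vh G K) {e : Finset Plane} (he : e ∈ cellEdges K) :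
    ContinuousOn (flux G κ K u) (poly e) := by
  obtain ⟨w, -, hw⟩ := mem_VhBdry_eqOn (isFlux_flux hκ hK ⟨u, hu⟩).1
  exact (continuousOn_edge w.2 he).congr fun x hx => hw x (poly_edge_subset_bdry he hx)

theorem MemVDG.add {u v : Broken} (hu : MemVDG G u) (hv : MemVDG G v) : MemVDG G (u + v) :=
  fun K hK => (Vh G K).add_mem (hu K hK) (hv K hK)

theorem MemVDG.sub {u v : Broken} (hu : MemVDG G u) (hv : MemVDG G v) : MemVDG G (u - v) :=
  fun K hK => (Vh G K).sub_mem (hu K hK) (hv K hK)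

theorem continuousOn_jump {u : Broken} (hu : MemVDG G u) {e : Finset Plane}
    (he : e ∈ G.coarse.edges) : ContinuousOn (jump G e u) (poly e) := by
  obtain ⟨hp, hpe⟩ := G.plus_mem e he
  have h1 := continuousOn_edge (hu _ hp) hpe
  by_cases hi : G.coarse.IsInterior e
  · obtain ⟨hm, hme, -⟩ := G.minus_mem e he hi
    exact (h1.sub (continuousOn_edge (hu _ hm) hme)).congr fun x _ => by simp [jump, hi]
  · exact h1.congr fun x _ => by simp [jump, hi]

theorem continuousOn_avgFlux (hκ : IsCoefficient G κ) {u : Broken} (hu : MemVDG G u)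
    {e : Finset Plane} (he : e ∈ G.coarse.edges) : ContinuousOn (avgFlux G κ e u) (poly e) := by
  obtain ⟨hp, hpe⟩ := G.plus_mem e he
  have h1 := continuousOn_flux hκ hp (hu _ hp) hpe
  by_cases hi : G.coarse.IsInterior e
  · obtain ⟨hm, hme, -⟩ := G.minus_mem e he hi
    refine ((h1.add (continuousOn_flux hκ hm (hu _ hm) hme).neg).div_const 2).congr
      fun x _ => by simp [avgFlux, hi]
  · exact h1.congr fun x _ => by simp [avgFlux, hi]

theorem integrableOn_coarse_edge {e : Finset Plane} (he : e ∈ G.coarse.edges) {g : Plane → ℝ}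
    (hg : ContinuousOn g (poly e)) : IntegrableOn g (poly e) μH[1] :=
  integrableOn_edge (G.plus_mem e he).2 hg

theorem integrableOn_coarse_edge_sq {e : Finset Plane} (he : e ∈ G.coarse.edges) {g : Plane → ℝ}
    (hg : ContinuousOn g (poly e)) : IntegrableOn (fun x => g x ^ 2) (poly e) μH[1] :=
  integrableOn_coarse_edge he (hg.pow 2)

theorem jump_add (u v : Broken) (e : Finset Plane) (x : Plane) :
    jump G e (u + v) x = jump G e u x + jump G e v x := by
  simp only [jump, Pi.add_apply]
  split_ifs <;> ring

theorem avgFlux_add (hκ : IsCoefficient G κ) {u v : Broken} (hu : MemVDG G u) (hv : MemVDG G v)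
    {e : Finset Plane} (he : e ∈ G.coarse.edges) (x : Plane) :
    avgFlux G κ e (u + v) x = avgFlux G κ e u x + avgFlux G κ e v x := by
  obtain ⟨hp, -⟩ := G.plus_mem e he
  by_cases hi : G.coarse.IsInterior e
  · obtain ⟨hm, -, -⟩ := G.minus_mem e he hi
    simp only [avgFlux, hi, if_true, Pi.add_apply, flux_add hκ hp (hu _ hp) (hv _ hp),
      flux_add hκ hm (hu _ hm) (hv _ hm)]
    ring
  · simp only [avgFlux, hi, if_false, Pi.add_apply, flux_add hκ hp (hu _ hp) (hv _ hp)]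

/-- Exchanging the sums, an edge collects `a K e` from every cell having it as an edge. An interior
edge gets at least its two distinct sides, and the remaining terms are nonnegative. -/
theorem sum_edges_le {a : Finset Plane → Finset Plane → ℝ} {b : Finset Plane → ℝ}
    (ha : ∀ K e, 0 ≤ a K e)
    (hint : ∀ e ∈ G.coarse.edges, G.coarse.IsInterior e →
      b e ≤ a (G.plus e) e + a (G.minus e) e)
    (hbd : ∀ e ∈ G.coarse.edges, ¬ G.coarse.IsInterior e → b e ≤ a (G.plus e) e) :
    ∑ e ∈ G.coarse.edges, b e ≤ ∑ K ∈ G.coarse.cells, ∑ e ∈ cellEdges K, a K e := by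
  classical
  rw [Finset.sum_comm' (t' := G.coarse.edges)
    (s' := fun e => G.coarse.cells.filter fun K => e ∈ cellEdges K)]
  · refine Finset.sum_le_sum fun e he => ?_
    obtain ⟨hp, hpe⟩ := G.plus_mem e he
    by_cases hi : G.coarse.IsInterior e
    · obtain ⟨hm, hme, hne⟩ := G.minus_mem e he hi
      refine (hint e he hi).trans ?_
      rw [← Finset.sum_pair (f := fun K => a K e) hne.symm]
      refine Finset.sum_le_sum_of_subset_of_nonneg ?_ fun K _ _ => ha K e
      intro K hK
      rw [Finset.mem_insert, Finset.mem_singleton] at hK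
      rcases hK with rfl | rfl
      · exact Finset.mem_filter.2 ⟨hp, hpe⟩
      · exact Finset.mem_filter.2 ⟨hm, hme⟩
    · exact (hbd e he hi).trans (Finset.single_le_sum (f := fun K => a K e)
        (fun K _ => ha K e) (Finset.mem_filter.2 ⟨hp, hpe⟩))
  · intro K e
    rw [Finset.mem_filter]
    exact ⟨fun h => ⟨⟨h.1, h.2⟩, mem_edges h.1 h.2⟩, fun h => h.1⟩

theorem edgeIntegral_sq_nonneg (e : Finset Plane) (g : Plane → ℝ) :
    0 ≤ edgeIntegral e fun x => g x ^ 2 := integral_nonneg fun _ => sq_nonneg _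

theorem edgeIntegral_const_mul (e : Finset Plane) (c : ℝ) (g : Plane → ℝ) :
    edgeIntegral e (fun x => c * g x) = c * edgeIntegral e g := integral_const_mul _ _

/-- For weights `p, q` on the two sides, `(p + q)/2 · (a²/p + b²/q) ≥ (a² + b²)/2 ≥ ((a - b)/2)²`.
The arithmetic mean in `κ̄` thus controls any contrast across the edge. -/
theorem edgeIntegral_avgFlux_sq_le (hκ : IsCoefficient G κ) {u : Broken} (hu : MemVDG G u)
    {e : Finset Plane} (he : e ∈ G.coarse.edges) :
    (G.coarse.IsInterior e → edgeIntegral e (fun x => avgFlux G κ e u x ^ 2) ≤ edgeKappa G κ e *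
      ((cellMax κ (G.plus e))⁻¹ *
          edgeIntegral e (fun x => flux G κ (G.plus e) (u (G.plus e)) x ^ 2) +
        (cellMax κ (G.minus e))⁻¹ *
          edgeIntegral e (fun x => flux G κ (G.minus e) (u (G.minus e)) x ^ 2))) ∧
    (¬ G.coarse.IsInterior e → edgeIntegral e (fun x => avgFlux G κ e u x ^ 2) ≤
      edgeKappa G κ e * ((cellMax κ (G.plus e))⁻¹ *
        edgeIntegral e (fun x => flux G κ (G.plus e) (u (G.plus e)) x ^ 2))) := by
  obtain ⟨hp, hpe⟩ := G.plus_mem e he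
  have hp1 := hκ.one_le_cellMax hp
  refine ⟨fun hi => ?_, fun hi => ?_⟩
  · obtain ⟨hm, hme, -⟩ := G.minus_mem e he hi
    have hm1 := hκ.one_le_cellMax hm
    have i1 := integrableOn_coarse_edge_sq he (continuousOn_flux hκ hp (hu _ hp) hpe)
    have i2 := integrableOn_coarse_edge_sq he (continuousOn_flux hκ hm (hu _ hm) hme)
    have i0 := integrableOn_coarse_edge_sq he (continuousOn_avgFlux hκ hu he)
    simp only [edgeIntegral]
    rw [← integral_const_mul, ← integral_const_mul,
      ← integral_add (i1.const_mul _) (i2.const_mul _), ← integral_const_mul]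
    refine integral_mono i0 (((i1.const_mul _).add (i2.const_mul _)).const_mul _) fun x => ?_
    simp only [avgFlux, edgeKappa, hi, if_true]
    set a := flux G κ (G.plus e) (u (G.plus e)) x
    set b := flux G κ (G.minus e) (u (G.minus e)) x
    set p := cellMax κ (G.plus e)
    set q := cellMax κ (G.minus e)
    have hp0 : 0 < p := by linarith
    have hq0 : 0 < q := by linarith
    have e1 : (p + q) / 2 * (p⁻¹ * a ^ 2 + q⁻¹ * b ^ 2)
        = a ^ 2 / 2 + b ^ 2 / 2 + (q * p⁻¹ * a ^ 2 + p * q⁻¹ * b ^ 2) / 2 := by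
      field_simp
      ring
    rw [e1]
    have : 0 ≤ q * p⁻¹ * a ^ 2 + p * q⁻¹ * b ^ 2 := by positivity
    nlinarith [sq_nonneg (a + b)]
  · rw [← mul_assoc]
    simp only [avgFlux, edgeKappa, hi, if_false]
    rw [mul_inv_cancel₀ (by linarith), one_mul]

end EdgeTraces

/-! ### Properties of the DG form: coercivity, locality and quasi-optimality. -/

section Form

theorem aDG_symm (hκ : IsCoefficient G κ) {u v : Broken} (hu : MemVDG G u) (hv : MemVDG G v)
    (γ : ℝ) : aDG G κ γ u v = aDG G κ γ v u := by
  have h1 : ∑ K ∈ G.coarse.cells, energy κ K (u K) (v K)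
      = ∑ K ∈ G.coarse.cells, energy κ K (v K) (u K) :=
    Finset.sum_congr rfl fun K hK => by
      rw [energy_eq_energyForm hκ hK ⟨_, hu K hK⟩ ⟨_, hv K hK⟩, energyForm_symm,
        energy_eq_energyForm hκ hK ⟨_, hv K hK⟩ ⟨_, hu K hK⟩]
  rw [aDG, aDG, h1]
  simp only [mul_comm (jump G _ u _) (jump G _ v _),
    add_comm (avgFlux G κ _ u _ * jump G _ v _) (avgFlux G κ _ v _ * jump G _ u _)]

theorem energy_add_left (hκ : IsCoefficient G κ) (hK : K ∈ G.coarse.cells)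
    {u u' v : Plane → ℝ} (hu : u ∈ Vh G K) (hu' : u' ∈ Vh G K) (hv : v ∈ Vh G K) :
    energy κ K (u + u') v = energy κ K u v + energy κ K u' v := by
  have h1 := energy_eq_energyForm hκ hK ⟨u, hu⟩ ⟨v, hv⟩
  have h2 := energy_eq_energyForm hκ hK ⟨u', hu'⟩ ⟨v, hv⟩
  have h3 := energy_eq_energyForm hκ hK (⟨u, hu⟩ + ⟨u', hu'⟩) ⟨v, hv⟩
  rw [map_add, LinearMap.add_apply, ← h1, ← h2] at h3
  exact h3

theorem aDG_add_left (hκ : IsCoefficient G κ) {u u' v : Broken} (hu : MemVDG G u)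
    (hu' : MemVDG G u') (hv : MemVDG G v) (γ : ℝ) :
    aDG G κ γ (u + u') v = aDG G κ γ u v + aDG G κ γ u' v := by
  have h1 : ∑ K ∈ G.coarse.cells, energy κ K ((u + u') K) (v K)
      = ∑ K ∈ G.coarse.cells, energy κ K (u K) (v K)
        + ∑ K ∈ G.coarse.cells, energy κ K (u' K) (v K) := by
    rw [← Finset.sum_add_distrib]
    refine Finset.sum_congr rfl fun K hK => ?_
    exact energy_add_left hκ hK (hu K hK) (hu' K hK) (hv K hK)
  have hint : ∀ {w w' : Broken}, MemVDG G w → MemVDG G w' → ∀ e ∈ G.coarse.edges,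
      IntegrableOn (fun x => avgFlux G κ e w x * jump G e w' x + avgFlux G κ e w' x * jump G e w x)
        (poly e) μH[1] := fun hw hw' e he => integrableOn_coarse_edge he
    (((continuousOn_avgFlux hκ hw he).mul (continuousOn_jump hw' he)).add
      ((continuousOn_avgFlux hκ hw' he).mul (continuousOn_jump hw he)))
  have h2 : ∑ e ∈ G.coarse.edges, edgeIntegral e (fun x =>
        avgFlux G κ e (u + u') x * jump G e v x + avgFlux G κ e v x * jump G e (u + u') x)
      = ∑ e ∈ G.coarse.edges, edgeIntegral e (fun x =>
        avgFlux G κ e u x * jump G e v x + avgFlux G κ e v x * jump G e u x)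
      + ∑ e ∈ G.coarse.edges, edgeIntegral e (fun x =>
        avgFlux G κ e u' x * jump G e v x + avgFlux G κ e v x * jump G e u' x) := by
    rw [← Finset.sum_add_distrib]
    refine Finset.sum_congr rfl fun e he => ?_
    rw [edgeIntegral, edgeIntegral, edgeIntegral, ← integral_add (hint hu hv e he)
      (hint hu' hv e he)]
    congr 1
    ext x
    rw [avgFlux_add hκ hu hu' he, jump_add]
    ring
  have h3 : ∑ e ∈ G.coarse.edges, γ / G.fine.size * edgeIntegral e (fun x =>
        edgeKappa G κ e * (jump G e (u + u') x * jump G e v x))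
      = ∑ e ∈ G.coarse.edges, γ / G.fine.size * edgeIntegral e (fun x =>
        edgeKappa G κ e * (jump G e u x * jump G e v x))
      + ∑ e ∈ G.coarse.edges, γ / G.fine.size * edgeIntegral e (fun x =>
        edgeKappa G κ e * (jump G e u' x * jump G e v x)) := by
    rw [← Finset.sum_add_distrib]
    refine Finset.sum_congr rfl fun e he => ?_
    have hjj : ∀ {w : Broken}, MemVDG G w → IntegrableOn
        (fun x => edgeKappa G κ e * (jump G e w x * jump G e v x)) (poly e) μH[1] := fun hw =>
      (integrableOn_coarse_edge he
        ((continuousOn_jump hw he).mul (continuousOn_jump hv he))).const_mul _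
    rw [← mul_add, edgeIntegral, edgeIntegral, edgeIntegral, ← integral_add (hjj hu) (hjj hu')]
    congr 2
    ext x
    rw [jump_add]
    ring
  rw [aDG, aDG, aDG, h1, h2, h3]
  ring

theorem sum_avgFlux_sq_le (hκ : IsCoefficient G κ) {c : ℝ} (hc : IsInverseConstant G κ c)
    {u : Broken} (hu : MemVDG G u) :
    ∑ e ∈ G.coarse.edges, (edgeKappa G κ e)⁻¹ * edgeIntegral e (fun x => avgFlux G κ e u x ^ 2) ≤
      c ^ 2 * (G.fine.size)⁻¹ * ∑ K ∈ G.coarse.cells, energy κ K (u K) (u K) := by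
  -- The absolute value makes the summand nonnegative for every `K`, as `sum_edges_le` asks; on
  -- actual cells it changes nothing.
  refine (sum_edges_le (G := G) (a := fun K e => |cellMax κ K|⁻¹ *
    edgeIntegral e (fun x => flux G κ K (u K) x ^ 2)) (fun K e => mul_nonneg (by positivity)
      (edgeIntegral_sq_nonneg _ _)) ?_ ?_).trans ?_
  · intro e he hi
    have hp1 := hκ.one_le_cellMax (G.plus_mem e he).1
    have hm1 := hκ.one_le_cellMax (G.minus_mem e he hi).1
    have hk := one_le_edgeKappa hκ he
    rw [abs_of_pos (by linarith), abs_of_pos (by linarith), inv_mul_le_iff₀ (by linarith)]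
    exact (edgeIntegral_avgFlux_sq_le hκ hu he).1 hi
  · intro e he hi
    have hp1 := hκ.one_le_cellMax (G.plus_mem e he).1
    have hk := one_le_edgeKappa hκ he
    rw [abs_of_pos (by linarith), inv_mul_le_iff₀ (by linarith)]
    exact (edgeIntegral_avgFlux_sq_le hκ hu he).2 hi
  · rw [Finset.mul_sum]
    refine Finset.sum_le_sum fun K hK => ?_
    have h1 := hκ.one_le_cellMax hK
    have h2 := bdryIntegral_flux_sq_le hκ hK hc ⟨_, hu K hK⟩
    rw [← Finset.mul_sum, abs_of_pos (by linarith), inv_mul_le_iff₀ (by linarith),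
      energy_eq_energyForm hκ hK ⟨_, hu K hK⟩ ⟨_, hu K hK⟩]
    refine h2.trans (le_of_eq ?_)
    ring

/-- This gives coercivity and continuity at once: the difference is minus the consistency term, a
product of averaged flux and jump, which Young and the flux bound split between the energy and the
penalty. -/
theorem abs_aDG_sub_dgNormSq_le (hκ : IsCoefficient G κ) {c γ : ℝ}
    (hc : IsInverseConstant G κ c) (hγ : c ^ 2 < γ) {u : Broken} (hu : MemVDG G u) :
    |aDG G κ γ u u - dgNormSq G κ γ u| ≤ c / √γ * dgNormSq G κ γ u := by
  -- Without cells everything vanishes; a cell is needed to know that the fine mesh size is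
  -- positive.
  rcases G.coarse.cells.eq_empty_or_nonempty with hemp | ⟨K₀, hK₀⟩
  · simp [aDG, dgNormSq, hemp, PolyMesh.edges]
  have hh := fine_size_pos hK₀
  have hc0 := hc.1
  have hγ0 : 0 < γ := (sq_nonneg c).trans_lt hγ
  have hs := Real.sqrt_pos.2 hγ0
  have hss := Real.mul_self_sqrt hγ0.le
  set X := ∑ e ∈ G.coarse.edges, edgeIntegral e (fun x =>
        avgFlux G κ e u x * jump G e u x + avgFlux G κ e u x * jump G e u x) with hX
  set A := ∑ K ∈ G.coarse.cells, energy κ K (u K) (u K) with hA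
  have hJ : ∑ e ∈ G.coarse.edges, γ / G.fine.size *
        edgeIntegral e (fun x => edgeKappa G κ e * jump G e u x ^ 2)
      = γ / G.fine.size * ∑ e ∈ G.coarse.edges, edgeKappa G κ e *
        edgeIntegral e (fun x => jump G e u x ^ 2) := by
    simp only [edgeIntegral_const_mul, Finset.mul_sum]
  set J := ∑ e ∈ G.coarse.edges, edgeKappa G κ e *
        edgeIntegral e (fun x => jump G e u x ^ 2) with hJdef
  have hdiff : aDG G κ γ u u - dgNormSq G κ γ u = -X := by
    rw [aDG, dgNormSq]
    simp only [← sq (jump G _ u _)]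
    ring
  rw [hdiff, abs_neg, dgNormSq, hJ]
  -- This `t` balances the two sides: `t c²/h = c/√γ` in front of the energy, and `t⁻¹ =
  -- (c/√γ)(γ/h)` in front of the jumps.
  set t := G.fine.size / (c * √γ) with ht
  have ht0 : 0 < t := by positivity
  have hedge : |X| ≤ t * (∑ e ∈ G.coarse.edges, (edgeKappa G κ e)⁻¹ *
      edgeIntegral e (fun x => avgFlux G κ e u x ^ 2)) + t⁻¹ * J := by
    rw [hX, hJdef, Finset.mul_sum, Finset.mul_sum, ← Finset.sum_add_distrib]
    refine (Finset.abs_sum_le_sum_abs _ _).trans (Finset.sum_le_sum fun e he => ?_)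
    have hk : 0 < edgeKappa G κ e := by linarith [one_le_edgeKappa hκ he]
    have hcA := continuousOn_avgFlux hκ hu he
    have hcJ := continuousOn_jump hu he
    have i1 := integrableOn_coarse_edge_sq he hcA
    have i2 := integrableOn_coarse_edge_sq he hcJ
    simp only [edgeIntegral]
    rw [← mul_assoc, ← mul_assoc, ← integral_const_mul, ← integral_const_mul,
      ← integral_add (i1.const_mul _) (i2.const_mul _)]
    refine abs_integral_le_integral_abs.trans (integral_mono
      (integrableOn_coarse_edge he ((hcA.mul hcJ).add (hcA.mul hcJ))).abs
      ((i1.const_mul _).add (i2.const_mul _)) fun x => ?_)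
    beta_reduce
    generalize avgFlux G κ e u x = p
    generalize jump G e u x = q
    generalize edgeKappa G κ e = k at hk
    have e1 : ∀ r : ℝ, t * k⁻¹ * p ^ 2 + t⁻¹ * k * r ^ 2 - 2 * (p * r)
        = t * k⁻¹ * (p - t⁻¹ * k * r) ^ 2 := by
      intro r
      field_simp
      ring
    have e2 : ∀ r : ℝ, 0 ≤ t * k⁻¹ * (p - t⁻¹ * k * r) ^ 2 := fun r => by positivity
    rw [abs_le]
    have a1 := e1 q
    have a2 := e1 (-q)
    have b1 := e2 q
    have b2 := e2 (-q)
    rw [neg_sq] at a2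
    constructor <;> linarith
  have hF := mul_le_mul_of_nonneg_left (sum_avgFlux_sq_le hκ hc hu) ht0.le
  have c1 : t * (c ^ 2 * (G.fine.size)⁻¹ * A) = c / √γ * A := by
    rw [ht]
    field_simp
  have c2 : t⁻¹ * J = c / √γ * (γ / G.fine.size * J) := by
    rw [ht]
    have : c / √γ * (γ / G.fine.size * J) = c / √γ * (√γ * √γ / G.fine.size * J) := by rw [hss]
    rw [this]
    field_simp
  rw [← hA, c1] at hF
  rw [mul_add, ← c2]
  linarith

/-- On an interior edge `(a - b)² ≤ 2a² + 2b²`, the source of the factor 2, and `κ̄` is at most `κ̃`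
of either side. The bound decouples the cells, so `v` can be chosen locally. -/
theorem dgNormSq_le_sum (hκ : IsCoefficient G κ) {γ : ℝ} (hγ : 0 < γ) {z : Broken}
    (hz : MemVDG G z) : dgNormSq G κ γ z ≤ ∑ K ∈ G.coarse.cells, (energy κ K (z K) (z K) +
      2 * (γ / G.fine.size) * (cellKappa G κ K * bdryIntegral K (fun x => z K x ^ 2))) := by
  rcases G.coarse.cells.eq_empty_or_nonempty with hemp | ⟨K₀, hK₀⟩
  · simp [dgNormSq, hemp, PolyMesh.edges]
  have hh := fine_size_pos hK₀
  rw [dgNormSq, Finset.sum_add_distrib]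
  refine add_le_add le_rfl ?_
  have hpos : 0 ≤ γ / G.fine.size := by positivity
  have key : ∀ K ∈ G.coarse.cells, 2 * (γ / G.fine.size) *
      (cellKappa G κ K * bdryIntegral K (fun x => z K x ^ 2)) = ∑ e ∈ cellEdges K,
      γ / G.fine.size * (2 * |cellKappa G κ K| * edgeIntegral e (fun x => z K x ^ 2)) := by
    intro K hK
    rw [abs_of_pos (cellKappa_pos hκ hK), ← Finset.mul_sum, ← Finset.mul_sum, bdryIntegral]
    ring
  rw [Finset.sum_congr rfl key]
  refine sum_edges_le (a := fun K e => γ / G.fine.size *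
    (2 * |cellKappa G κ K| * edgeIntegral e (fun x => z K x ^ 2)))
    (fun K e => mul_nonneg hpos (mul_nonneg (by positivity) (edgeIntegral_sq_nonneg _ _))) ?_ ?_
  · intro e he hi
    obtain ⟨hp, hpe⟩ := G.plus_mem e he
    obtain ⟨hm, hme, -⟩ := G.minus_mem e he hi
    rw [← mul_add]
    refine mul_le_mul_of_nonneg_left ?_ hpos
    have hk1 := (edgeKappa_le_cellKappa (G := G) (κ := κ) hpe).trans (le_abs_self _)
    have hk2 := (edgeKappa_le_cellKappa (G := G) (κ := κ) hme).trans (le_abs_self _)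
    have hk0 := one_le_edgeKappa hκ he
    have i1 := integrableOn_coarse_edge_sq he (continuousOn_edge (hz _ hp) hpe)
    have i2 := integrableOn_coarse_edge_sq he (continuousOn_edge (hz _ hm) hme)
    have i0 := integrableOn_coarse_edge_sq he (continuousOn_jump hz he)
    simp only [edgeIntegral]
    rw [← integral_const_mul, ← integral_const_mul,
      ← integral_add (i1.const_mul _) (i2.const_mul _)]
    refine integral_mono (i0.const_mul _) ((i1.const_mul _).add (i2.const_mul _)) fun x => ?_
    simp only [jump, hi, if_true]
    generalize z (G.plus e) x = a
    generalize z (G.minus e) x = b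
    have h1 := mul_le_mul_of_nonneg_right hk1 (sq_nonneg a)
    have h2 := mul_le_mul_of_nonneg_right hk2 (sq_nonneg b)
    have h3 : edgeKappa G κ e * (a - b) ^ 2 ≤ edgeKappa G κ e * (2 * a ^ 2 + 2 * b ^ 2) :=
      mul_le_mul_of_nonneg_left (by nlinarith [sq_nonneg (a + b)]) (by linarith)
    linarith
  · intro e he hi
    obtain ⟨hp, hpe⟩ := G.plus_mem e he
    refine mul_le_mul_of_nonneg_left ?_ hpos
    have hk1 := (edgeKappa_le_cellKappa (G := G) (κ := κ) hpe).trans (le_abs_self _)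
    have hk0 := one_le_edgeKappa hκ he
    simp only [jump, hi, if_false, edgeIntegral_const_mul]
    refine mul_le_mul_of_nonneg_right ?_ (edgeIntegral_sq_nonneg _ _)
    linarith

theorem energy_zero_right (hκ : IsCoefficient G κ) (hK : K ∈ G.coarse.cells) {u : Plane → ℝ}
    (hu : u ∈ Vh G K) : energy κ K u 0 = 0 :=
  (energy_eq_energyForm hκ hK ⟨u, hu⟩ 0).trans (map_zero _)

/-- Functions with zero trace have neither jumps nor flux, so all edge terms drop out. -/
theorem aDG_of_mem_Vh0 (hκ : IsCoefficient G κ) {u v : Broken}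
    (hv : ∀ K ∈ G.coarse.cells, v K ∈ Vh0 G K) (γ : ℝ) :
    aDG G κ γ u v = ∑ K ∈ G.coarse.cells, energy κ K (u K) (v K) := by
  have hj : ∀ e ∈ G.coarse.edges, ∀ x ∈ poly e, jump G e v x = 0 := by
    intro e he x hx
    obtain ⟨hp, hpe⟩ := G.plus_mem e he
    have h1 := (hv _ hp).2 x (poly_edge_subset_bdry hpe hx)
    by_cases hi : G.coarse.IsInterior e
    · obtain ⟨hm, hme, -⟩ := G.minus_mem e he hi
      simp only [jump, hi, if_true, h1, (hv _ hm).2 x (poly_edge_subset_bdry hme hx), sub_zero]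
    · simp only [jump, hi, if_false, h1]
  have hf : ∀ e ∈ G.coarse.edges, ∀ x, avgFlux G κ e v x = 0 := by
    intro e he x
    obtain ⟨hp, hpe⟩ := G.plus_mem e he
    have h1 := flux_eq_zero hκ hp (hv _ hp)
    by_cases hi : G.coarse.IsInterior e
    · obtain ⟨hm, hme, -⟩ := G.minus_mem e he hi
      simp [avgFlux, hi, h1, flux_eq_zero hκ hm (hv _ hm)]
    · simp [avgFlux, hi, h1]
  have h2 : ∑ e ∈ G.coarse.edges, edgeIntegral e (fun x =>
        avgFlux G κ e u x * jump G e v x + avgFlux G κ e v x * jump G e u x) = 0 :=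
    Finset.sum_eq_zero fun e he => setIntegral_eq_zero_of_forall_eq_zero fun x hx => by
      rw [hj e he x hx, hf e he x, mul_zero, zero_mul, add_zero]
  have h3 : ∑ e ∈ G.coarse.edges, γ / G.fine.size * edgeIntegral e (fun x =>
        edgeKappa G κ e * (jump G e u x * jump G e v x)) = 0 :=
    Finset.sum_eq_zero fun e he => by
      rw [edgeIntegral, setIntegral_eq_zero_of_forall_eq_zero, mul_zero]
      intro x hx
      rw [hj e he x hx, mul_zero, mul_zero]
  rw [aDG, h2, h3]
  ring

/-- Inside a cell the discrete problem is local. -/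
theorem energy_eq_load_of_mem_Vh0 (hκ : IsCoefficient G κ) (hK : K ∈ G.coarse.cells) {γ : ℝ}
    {f : Plane → ℝ} {u : Broken} (hu : MemVDG G u)
    (hsol : ∀ v, MemVDG G v → aDG G κ γ u v = load G f v) {w : Plane → ℝ} (hw : w ∈ Vh0 G K) :
    energy κ K (u K) w = ∫ x in poly K, f x * w x := by
  classical
  -- The test function is `w` on `K` and zero on every other cell, so both sums reduce to one term.
  let v : Broken := Function.update 0 K w
  have hvK : v K = w := Function.update_self _ _ _
  have hvL : ∀ L, L ≠ K → v L = 0 := fun L hL => Function.update_of_ne hL _ _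
  have hv : ∀ L ∈ G.coarse.cells, v L ∈ Vh0 G L := by
    intro L _
    by_cases hL : L = K
    · subst hL; rwa [hvK]
    · rw [hvL L hL]; exact (Vh0 G L).zero_mem
  have h := hsol v fun L hL => (hv L hL).1
  rw [aDG_of_mem_Vh0 hκ hv, load, Finset.sum_eq_single_of_mem K hK, Finset.sum_eq_single_of_mem K hK,
    hvK] at h
  · exact h
  · intro L _ hL
    rw [hvL L hL]
    simp
  · intro L hL hLK
    rw [hvL L hLK]
    exact energy_zero_right hκ hL (hu L hL)

/-- Quasi-optimality of the Galerkin solution. -/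
theorem dgNormSq_galerkin_le (hκ : IsCoefficient G κ) {c γ : ℝ}
    (hc : IsInverseConstant G κ c) (hγ : c ^ 2 < γ) {u w v : Broken} (hu : MemVDG G u)
    (hw : MemVDG G w) (hv : MemVDG G v)
    (horth : aDG G κ γ u (w - v) = aDG G κ γ w (w - v)) :
    (1 - c / √γ) * dgNormSq G κ γ (u - w) ≤ 2 * dgNormSq G κ γ (u - v) := by
  have hγ0 : 0 < γ := (sq_nonneg c).trans_lt hγ
  have hs := Real.sqrt_pos.2 hγ0
  have hθ : c / √γ < 1 := by
    rw [div_lt_one hs]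
    exact Real.lt_sqrt_of_sq_lt hγ
  have hd : MemVDG G (w - v) := hw.sub hv
  have he : MemVDG G (u - w) := hu.sub hw
  have h1 := (abs_le.1 (abs_aDG_sub_dgNormSq_le hκ hc hγ he)).1
  have h2 := (abs_le.1 (abs_aDG_sub_dgNormSq_le hκ hc hγ (hu.sub hv))).2
  have h3 := (abs_le.1 (abs_aDG_sub_dgNormSq_le hκ hc hγ hd)).1
  have hnn : ∀ {z : Broken}, MemVDG G z → 0 ≤ dgNormSq G κ γ z := by
    intro z hz
    rcases G.coarse.cells.eq_empty_or_nonempty with hemp | ⟨K₀, hK₀⟩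
    · simp [dgNormSq, hemp, PolyMesh.edges]
    have hh := fine_size_pos hK₀
    refine add_nonneg (Finset.sum_nonneg fun K hK => ?_) (Finset.sum_nonneg fun e he => ?_)
    · rw [energy_eq_energyForm hκ hK ⟨_, hz K hK⟩ ⟨_, hz K hK⟩]
      exact energyForm_nonneg hκ hK _
    · rw [edgeIntegral_const_mul]
      have := one_le_edgeKappa hκ he
      exact mul_nonneg (by positivity) (mul_nonneg (by linarith) (edgeIntegral_sq_nonneg _ _))
  have h0 : aDG G κ γ (u - w) (w - v) = 0 := by
    have h := aDG_add_left hκ he hw hd γ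
    rw [sub_add_cancel] at h
    linarith
  -- Pythagoras: by `h0` the error `u - w` is orthogonal to `w - v`, and symmetry removes both cross
  -- terms.
  have h4 : aDG G κ γ (u - v) (u - v)
      = aDG G κ γ (u - w) (u - w) + aDG G κ γ (w - v) (w - v) := by
    have hsum : u - v = (u - w) + (w - v) := (sub_add_sub_cancel u w v).symm
    rw [hsum, aDG_add_left hκ he hd (he.add hd), aDG_symm hκ he (he.add hd),
      aDG_symm hκ hd (he.add hd), aDG_add_left hκ he hd he, aDG_add_left hκ he hd hd,
      aDG_symm hκ hd he, h0]
    ring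
  have n1 := hnn (hu.sub hv)
  have n2 := hnn hd
  have h5 : 0 ≤ aDG G κ γ (w - v) (w - v) := by
    have := mul_nonneg (sub_nonneg.2 hθ.le) n2
    linarith
  have h6 := mul_nonneg (sub_nonneg.2 hθ.le) n1
  -- With `θ = c/√γ`: `(1 - θ)‖u - w‖² ≤ a(u - w, u - w) ≤ a(u - v, u - v) ≤ (1 + θ)‖u - v‖²`, and
  -- `1 + θ ≤ 2`.
  linarith

end Form

/-! ### Approximation by the offline space on one cell. -/

theorem Voff_le_Vh {φ ξ : ℕ → Plane → ℝ} {lam₁ lam₂ : ℕ → ℝ}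
    (h₁ : IsEigenSystem (Vsnap1 G κ K) (energy κ K) (mass1 G κ K) φ lam₁)
    (h₂ : IsEigenSystem (Vh0 G K) (energy κ K) (mass2 G κ K) ξ lam₂) {l₁ l₂ : ℕ}
    (hl₁ : l₁ ≤ Module.finrank ℝ (Vsnap1 G κ K)) (hl₂ : l₂ ≤ Module.finrank ℝ (Vh0 G K)) :
    Voff φ ξ l₁ l₂ ≤ Vh G K := by
  refine sup_le (Submodule.span_le.2 ?_) (Submodule.span_le.2 ?_)
  · rintro _ ⟨k, hk, rfl⟩
    exact Vsnap1_le_Vh G κ K (h₁.mem k ⟨hk.1, hk.2.trans hl₁⟩)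
  · rintro _ ⟨k, hk, rfl⟩
    exact (h₂.mem k ⟨hk.1, hk.2.trans hl₂⟩).1

/-- Local approximation by the offline space, in the cell contribution of the DG norm. -/
theorem exists_offline_approx (hκ : IsCoefficient G κ) (hK : K ∈ G.coarse.cells)
    {φ ξ : ℕ → Plane → ℝ} {lam₁ lam₂ : ℕ → ℝ}
    (h₁ : IsEigenSystem (Vsnap1 G κ K) (energy κ K) (mass1 G κ K) φ lam₁)
    (h₂ : IsEigenSystem (Vh0 G K) (energy κ K) (mass2 G κ K) ξ lam₂) {l₁ l₂ : ℕ}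
    (hl₁ : 1 ≤ l₁ ∧ l₁ ≤ Module.finrank ℝ (Vsnap1 G κ K))
    (hl₂ : l₂ ≤ Module.finrank ℝ (Vh0 G K)) {γ : ℝ} (hγ : 0 < γ) {f u u₁ : Plane → ℝ}
    (hf : MemLp f 2 (volume.restrict (poly K))) (hu : u ∈ Vh G K)
    (hu₁ : IsHarmonicExt G κ K u u₁)
    (hloc : ∀ w ∈ Vh0 G K, energy κ K u w = ∫ x in poly K, f x * w x) :
    ∃ v ∈ Voff φ ξ l₁ l₂, energy κ K (u - v) (u - v) + 2 * (γ / G.fine.size) *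
        (cellKappa G κ K * bdryIntegral K (fun x => (u - v) x ^ 2)) ≤
      2 * ((G.coarse.size / cellKappa G κ K *
          invNext lam₁ (Module.finrank ℝ (Vsnap1 G κ K)) l₁) *
          (1 + γ * G.coarse.size / G.fine.size *
            invNext lam₁ (Module.finrank ℝ (Vsnap1 G κ K)) l₁) *
          bdryIntegral K (fun x => flux G κ K u₁ x ^ 2) +
        G.coarse.size ^ 2 * invNext lam₂ (Module.finrank ℝ (Vh0 G K)) l₂ *
          ∫ x in poly K, f x ^ 2) := by
  have hH := coarse_size_pos hK
  have hh := fine_size_pos hK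
  let U : Vh G K := ⟨u, hu⟩
  let U₁ : Vh G K := ⟨u₁, hu₁.1⟩
  have hU₁ : U₁.1 ∈ Vsnap1 G κ K := hu₁.mem_Vsnap1
  have hU₂ : (U - U₁).1 ∈ Vh0 G K :=
    ⟨(U - U₁).2, fun x hx => sub_eq_zero.2 (hu₁.2.2 x hx).symm⟩
  obtain ⟨v₁, hv₁, hv₁m, hA, hB, hp⟩ := exists_harmonic_approx hκ hK h₁ hl₁.1 hl₁.2 U₁ hU₁
  obtain ⟨v₂, hv₂, hv₂m, hE⟩ := exists_interior_approx hκ hK h₂ hl₂ (U - U₁) hU₂ hf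
    fun w hw => by
      rw [map_sub, LinearMap.sub_apply, energyForm_Vsnap1_Vh0 hκ hK hU₁ hw, sub_zero,
        ← hloc w.1 hw]
      exact (energy_eq_energyForm hκ hK U w).symm
  refine ⟨v₁.1 + v₂.1, Submodule.add_mem_sup hv₁ hv₂, ?_⟩
  -- The residual splits into a harmonic part `w₁` and a part `w₂` with zero trace: the energies
  -- add, and only `w₁` contributes to the boundary term.
  set w₁ := U₁ - v₁ with hw₁
  set w₂ := U - U₁ - v₂ with hw₂
  have hw₁m : w₁.1 ∈ Vsnap1 G κ K := (Vsnap1 G κ K).sub_mem hU₁ hv₁m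
  have hw₂m : w₂.1 ∈ Vh0 G K := (Vh0 G K).sub_mem hU₂ hv₂m
  have hz : u - (v₁.1 + v₂.1) = (w₁ + w₂).1 := by
    have : w₁ + w₂ = U - (v₁ + v₂) := by rw [hw₁, hw₂]; abel
    rw [this]
    rfl
  have hen : energyForm G κ K (w₁ + w₂) (w₁ + w₂)
      = energyForm G κ K w₁ w₁ + energyForm G κ K w₂ w₂ := by
    have h0 := energyForm_Vsnap1_Vh0 hκ hK hw₁m hw₂m
    have h0' := (energyForm_symm (κ := κ) w₂ w₁).trans h0
    simp only [map_add, LinearMap.add_apply, h0, h0']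
    ring
  have hbd : bdryIntegral K (fun x => (w₁ + w₂).1 x ^ 2) = bdryForm G K w₁ w₁ :=
    bdryIntegral_congr fun x hx => by
      have h0 : w₂.1 x = 0 := hw₂m.2 x hx
      change (w₁.1 x + w₂.1 x) ^ 2 = _
      rw [h0, add_zero, sq]
  rw [hz, energy_eq_energyForm hκ hK, hen, hbd]
  set p := invNext lam₁ (Module.finrank ℝ (Vsnap1 G κ K)) l₁ with hpdef
  set S := G.coarse.size / cellKappa G κ K * p * bdryIntegral K (fun x => flux G κ K u₁ x ^ 2)
    with hS
  set R := G.coarse.size ^ 2 * invNext lam₂ (Module.finrank ℝ (Vh0 G K)) l₂ *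
    ∫ x in poly K, f x ^ 2 with hR
  change energyForm G κ K w₁ w₁ ≤ S at hA
  -- The gap is used twice, from boundary mass to energy and from energy to flux, which produces the
  -- factor `γ H / (h λ)`.
  have h1 : γ / G.fine.size * (cellKappa G κ K * bdryForm G K w₁ w₁) ≤
      γ / G.fine.size * (G.coarse.size * p * S) :=
    mul_le_mul_of_nonneg_left (hB.trans (mul_le_mul_of_nonneg_left hA (by positivity)))
      (by positivity)
  have hA0 := (energyForm_nonneg hκ hK w₁).trans hA
  have hR0 := (energyForm_nonneg hκ hK w₂).trans hE
  have e : G.coarse.size / cellKappa G κ K * p * (1 + γ * G.coarse.size / G.fine.size * p) *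
      bdryIntegral K (fun x => flux G κ K u₁ x ^ 2)
      = S + γ / G.fine.size * (G.coarse.size * p * S) := by
    rw [hS]
    ring
  rw [e]
  linarith

end

end GMsDG

/-! ### Assembly of the error estimate. -/

theorem mainTheorem1 :
    (∀ G : GMsDG.Grids, ∃ Cinv : ℝ, ∀ κ : GMsDG.Plane → ℝ, GMsDG.IsCoefficient G κ →
      GMsDG.IsInverseConstant G κ Cinv) ∧
    ∃ C : ℝ → ℝ,
      ∀ (G : GMsDG.Grids) (κ : GMsDG.Plane → ℝ) (_ : GMsDG.IsCoefficient G κ)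
        (f : GMsDG.Plane → ℝ)
        (_ : MeasureTheory.MemLp f 2 (MeasureTheory.volume.restrict G.coarse.region))
        -- the constant of the inverse inequality and the penalty parameter
        (Cinv γ : ℝ) (_ : GMsDG.IsInverseConstant G κ Cinv) (_ : Cinv ^ 2 < γ)
        -- the eigenpairs of the two local spectral problems
        (φ ξ : Finset GMsDG.Plane → ℕ → GMsDG.Plane → ℝ)
        (lam₁ lam₂ : Finset GMsDG.Plane → ℕ → ℝ)
        (_ : ∀ K ∈ G.coarse.cells, GMsDG.IsEigenSystem (GMsDG.Vsnap1 G κ K)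
          (GMsDG.energy κ K) (GMsDG.mass1 G κ K) (φ K) (lam₁ K))
        (_ : ∀ K ∈ G.coarse.cells, GMsDG.IsEigenSystem (GMsDG.Vh0 G K)
          (GMsDG.energy κ K) (GMsDG.mass2 G κ K) (ξ K) (lam₂ K))
        -- the numbers of eigenfunctions used
        (l₁ l₂ : Finset GMsDG.Plane → ℕ)
        (_ : ∀ K ∈ G.coarse.cells,
          1 ≤ l₁ K ∧ l₁ K ≤ Module.finrank ℝ (GMsDG.Vsnap1 G κ K))
        (_ : ∀ K ∈ G.coarse.cells, l₂ K ≤ Module.finrank ℝ (GMsDG.Vh0 G K))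
        -- the fine grid solution, the multiscale solution and the harmonic projection
        (u_h u_H u_1 : GMsDG.Broken)
        (_ : GMsDG.MemVDG G u_h)
        (_ : ∀ v, GMsDG.MemVDG G v → GMsDG.aDG G κ γ u_h v = GMsDG.load G f v)
        (_ : ∀ K ∈ G.coarse.cells, u_H K ∈ GMsDG.Voff (φ K) (ξ K) (l₁ K) (l₂ K))
        (_ : ∀ v : GMsDG.Broken,
          (∀ K ∈ G.coarse.cells, v K ∈ GMsDG.Voff (φ K) (ξ K) (l₁ K) (l₂ K)) →
          GMsDG.aDG G κ γ u_H v = GMsDG.load G f v)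
        (_ : ∀ K ∈ G.coarse.cells, GMsDG.IsHarmonicExt G κ K (u_h K) (u_1 K)),
        GMsDG.dgNormSq G κ γ (u_h - u_H) ≤
          C (1 - Cinv / √γ) *
            ((∑ K ∈ G.coarse.cells,
                (G.coarse.size / GMsDG.cellKappa G κ K *
                  GMsDG.invNext (lam₁ K) (Module.finrank ℝ (GMsDG.Vsnap1 G κ K)) (l₁ K)) *
                (1 + γ * G.coarse.size / G.fine.size *
                  GMsDG.invNext (lam₁ K) (Module.finrank ℝ (GMsDG.Vsnap1 G κ K)) (l₁ K)) *
                GMsDG.bdryIntegral K (fun x => GMsDG.flux G κ K (u_1 K) x ^ 2))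
              + (∑ K ∈ G.coarse.cells,
                  G.coarse.size ^ 2 *
                  GMsDG.invNext (lam₂ K) (Module.finrank ℝ (GMsDG.Vh0 G K)) (l₂ K) *
                  (∫ x in GMsDG.poly K, f x ^ 2))
              + Cinv ^ 2 * ∑ e ∈ G.coarse.edges, 1 / G.fine.size *
                  GMsDG.edgeIntegral e
                    (fun x => GMsDG.edgeKappa G κ e * GMsDG.jump G e u_h x ^ 2)) := by
  -- The 4 is a factor 2 from quasi-optimality times a factor 2 from the local approximation; the
  -- denominator is the coercivity constant.
  refine ⟨GMsDG.exists_inverseConstant, fun t => 4 / t, ?_⟩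
  intro G κ hκ f hf c γ hc hγ φ ξ lam₁ lam₂ h₁ h₂ l₁ l₂ hl₁ hl₂ u_h u_H u_1 hu hsol hH hsolH hu₁
  have hγ0 : 0 < γ := (sq_nonneg c).trans_lt hγ
  have hθ : 0 < 1 - c / √γ := by
    rw [sub_pos, div_lt_one (Real.sqrt_pos.2 hγ0)]
    exact Real.lt_sqrt_of_sq_lt hγ
  -- A `Broken` function needs a value at every finite set; off the coarse cells it is set to 0.
  have hex : ∀ K, ∃ v : GMsDG.Plane → ℝ, K ∈ G.coarse.cells → _ := fun K => by
    by_cases hK : K ∈ G.coarse.cells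
    · obtain ⟨v, hv⟩ := GMsDG.exists_offline_approx hκ hK (h₁ K hK) (h₂ K hK) (hl₁ K hK)
        (hl₂ K hK) hγ0
        (hf.mono_measure (MeasureTheory.Measure.restrict_mono (GMsDG.poly_subset_region hK) le_rfl))
        (hu K hK) (hu₁ K hK) (fun w hw => GMsDG.energy_eq_load_of_mem_Vh0 hκ hK hu hsol hw)
      exact ⟨v, fun _ => hv⟩
    · exact ⟨0, fun h => absurd h hK⟩
  choose v hv using hex
  have hoff : ∀ {w : GMsDG.Broken},
      (∀ K ∈ G.coarse.cells, w K ∈ GMsDG.Voff (φ K) (ξ K) (l₁ K) (l₂ K)) → GMsDG.MemVDG G w :=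
    fun hw K hK => GMsDG.Voff_le_Vh (h₁ K hK) (h₂ K hK) (hl₁ K hK).2 (hl₂ K hK) (hw K hK)
  have hvoff : ∀ K ∈ G.coarse.cells, v K ∈ GMsDG.Voff (φ K) (ξ K) (l₁ K) (l₂ K) :=
    fun K hK => (hv K hK).1
  have hdoff : ∀ K ∈ G.coarse.cells, (u_H - v) K ∈ GMsDG.Voff (φ K) (ξ K) (l₁ K) (l₂ K) :=
    fun K hK => Submodule.sub_mem _ (hH K hK) (hvoff K hK)
  have hgal := GMsDG.dgNormSq_galerkin_le hκ hc hγ hu (hoff hH) (hoff hvoff)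
    ((hsol _ (hoff hdoff)).trans (hsolH _ hdoff).symm)
  have hdg := (GMsDG.dgNormSq_le_sum hκ hγ0 (hu.sub (hoff hvoff))).trans
    (Finset.sum_le_sum fun K hK => (hv K hK).2)
  rw [← Finset.mul_sum, Finset.sum_add_distrib] at hdg
  -- The other two sums already bound the error, so this one only has to be nonnegative.
  have hjump : 0 ≤ c ^ 2 * ∑ e ∈ G.coarse.edges, 1 / G.fine.size * GMsDG.edgeIntegral e
      (fun x => GMsDG.edgeKappa G κ e * GMsDG.jump G e u_h x ^ 2) := by
    refine mul_nonneg (sq_nonneg c) (Finset.sum_nonneg fun e he => ?_)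
    have hh := GMsDG.fine_size_pos (G.plus_mem e he).1
    have hk := GMsDG.one_le_edgeKappa hκ he
    rw [GMsDG.edgeIntegral_const_mul]
    exact mul_nonneg (by positivity)
      (mul_nonneg (by linarith) (GMsDG.edgeIntegral_sq_nonneg _ _))
  rw [div_mul_eq_mul_div, le_div_iff₀ hθ, mul_comm]
  refine hgal.trans ?_
  linarith
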